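/- Model. There are finitely many validators, of which a strict majority is honest and at least one is corrupt. Time proceeds in slots $1,2,\dots$; in each slot every validator is eligible with probability $p\in(0,1]$, independently over validators and slots. A validator creates at most one block per slot, and only when eligible. A block carries its slot, validator, a payload, a public-coin label $y$ and a non-empty set $\mathrm{refs}(b)$ of blocks created in earlier slots; $a\preceq b$ means that $a=b$ or $a$ is reached from $b$ by following references, and $\mathrm{Anc}^*(b)=\{a:a\preceq b\}$, $\mathrm{Desc}^*(b)=\{d:b\preceq d\}$. Initially there is only the genesis block (slot $0$). The network is synchronous: at the end of each slot all honest parties share the same view $V_t$ (a set of blocks). An eligible honest validator creates in slot $t$ a block that references all tips of $V_{t-1}$ (the blocks of $V_{t-1}$ not referenced within $V_{t-1}$), and this block belongs to $V_t$; its payload is sampled by an arbitrary procedure. The adversary sees the honest blocks of slot $t$, then may let each eligible corrupt validator create one block with arbitrary payload and arbitrary non-empty references to previously created blocks, and releases any set of blocks created so far; released blocks all of whose ancestors are known or released join $V_t$, all other blocks stay withheld. Its decisions depend only on the past and on the current slot. Payload conflict is a symmetric relation such that every finite set of payloads admits a payload conflicting with each of its members. Fork choice with infinite horizon. Two distinct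 conflicting tips $x,y$ of a view $V$ are compared by the unbounded subDAG weight $$W(x;c)=\sum_{d\in V\cap S(x)\cap\mathrm{Desc}^*(c)}|\mathrm{refs}(d)|,$$ which counts all references since genesis, without a window; the larger weight wins, and ties go to the larger label (then to the larger validator index). Here $S(x)$ is either $\mathrm{Desc}^*(x)$ for all tips or $\mathrm{Anc}^*(x)$ for all tips, and the anchor $c$ is either always the closest common ancestor of $x,y$ (the common strict ancestor with largest slot, ties broken by label and then validator index) or always genesis. The preferred frontier $F(V)$ is the set of tips that lose against no conflicting tip, and the ledger is $L(V)=V\cap\bigcup_{x\in F(V)}\mathrm{Anc}^*(x)$. A block $B\in L(V)$ is $k$-deep if every reference path from $B$ to a member of $F(V)$ has length at least $k$. Lemma (unsafe infinite-horizon subDAG weight). For each of these four versions of the weight there are an adversarial strategy and a constant $\varepsilon>0$ such that for every $k\in\mathbb N$ there are slots $t_1<t_2$ for which, with probability at least $\varepsilon$, the following happens: some honest block $B$ is $k$-deep in $V_{t_1}$ but $B\notin L(V_{t_2})$, while $F(V_{t_2})\neq\emptyset$; and some block created in a slot $\le t_1-k$ that was still withheld at the end of slot $t_1$ belongs to $V_{t_2}$.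 -/

import Mathlib

open MeasureTheory ProbabilityTheory
open scoped Classical

noncomputable section

namespace SubDAG

universe u

/-- Blocks over the validator set `Fin n` with payloads in `P`. A block other than genesis carries
its slot, its validator, its payload, its public-coin label and the list of blocks it references. -/
inductive Block (n : ℕ) (P : Type u) : Type u
  | genesis : Block n P
  | mk (slot : ℕ) (validator : Fin n) (payload : P) (label : ℝ) (refs : List (Block n P)) : Block n P

namespace Block

variable {n : ℕ} {P : Type u}

def slot : Block n P → ℕ
  | genesis => 0
  | mk s _ _ _ _ => s

def validator : Block n P → Option (Fin n)
  | genesis => none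
  | mk _ v _ _ _ => some v

def payload : Block n P → Option P
  | genesis => none
  | mk _ _ a _ _ => some a

def label : Block n P → ℝ
  | genesis => 0
  | mk _ _ _ y _ => y

/-- The set of referenced blocks; its cardinality counts each referenced block once. -/
def refs : Block n P → Finset (Block n P)
  | genesis => ∅
  | mk _ _ _ _ r => r.toFinset

/-- Position of the validator in the validator list. -/
def index : Block n P → ℕ
  | genesis => 0
  | mk _ v _ _ _ => (v : ℕ) + 1

/-- Public-coin label; equal labels are separated by the validator index. -/
def coinKey (b : Block n P) : ℝ ×ₗ ℕ := toLex (b.label, b.index)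

/-- Slot first, then the public-coin label. -/
def slotKey (b : Block n P) : ℕ ×ₗ (ℝ ×ₗ ℕ) := toLex (b.slot, b.coinKey)

end Block

variable {n : ℕ} {P : Type u}

/-- The edge `a → b` of the reference DAG: `b` references `a`. -/
def Edge (a b : Block n P) : Prop := a ∈ b.refs

/-- Strict ancestry: a nonempty directed path from `a` to `b`. -/
def Anc (a b : Block n P) : Prop := Relation.TransGen Edge a b

/-- Reflexive ancestry, `a ≼ b`. -/
def AncEq (a b : Block n P) : Prop := Relation.ReflTransGen Edge a b

/-- There is a directed path with exactly `m` edges from `a` to `b`. -/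
def RefPath : ℕ → Block n P → Block n P → Prop
  | 0, a, b => a = b
  | m + 1, a, b => ∃ c, RefPath m a c ∧ Edge c b

/-! ### Fork choice with an infinite horizon -/

/-- Tips of a view: blocks that no block of the view references. -/
def tips (V : Finset (Block n P)) : Finset (Block n P) :=
  V.filter fun b => ∀ d ∈ V, ¬ Edge b d

/-- `c` is the closest common ancestor of `x` and `y` in the view `V`. -/
def IsCCA (V : Finset (Block n P)) (x y c : Block n P) : Prop :=
  (c ∈ V ∧ Anc c x ∧ Anc c y) ∧
    ∀ c' ∈ V, Anc c' x → Anc c' y → c'.slotKey ≤ c.slotKey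

/-- Where the competition between two tips is anchored: at their closest common ancestor, or at
genesis. -/
inductive Anchor
  | cca
  | genesis

def IsAnchor : Anchor → Finset (Block n P) → Block n P → Block n P → Block n P → Prop
  | .cca, V, x, y, c => IsCCA V x y c
  | .genesis, _, _, _, c => c = Block.genesis

/-- Which blocks above the anchor belong to the subDAG of a tip `x`: the members of `Desc*(x)`, or
the blocks between the anchor and `x`, i.e. the members of `Anc*(x)`. -/
inductive Region
  | descendants
  | between

def InRegion : Region → Block n P → Block n P → Prop
  | .descendants, x, d => AncEq x d
  | .between, x, d => AncEq d x

/-- SubDAG weight of `x` above the anchor `c` with an unbounded window: every reference made by a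
block of the subDAG counts, however old it is. -/
def weight (R : Region) (V : Finset (Block n P)) (x c : Block n P) : ℕ :=
  ∑ d ∈ V.filter (fun d => InRegion R x d ∧ AncEq c d), d.refs.card

def ConflictingBlocks (conflicts : P → P → Prop) (x y : Block n P) : Prop :=
  ∃ a b, x.payload = some a ∧ y.payload = some b ∧ conflicts a b

/-- Resolution of two conflicting tips in favour of `x`: larger weight, then larger label. -/
def Beats (R : Region) (K : Anchor) (V : Finset (Block n P)) (x y : Block n P) : Prop :=
  ∃ c, IsAnchor K V x y c ∧
    (weight R V y c < weight R V x c ∨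
      (weight R V y c = weight R V x c ∧ y.coinKey < x.coinKey))

/-- The preferred frontier: tips that are not defeated by a conflicting tip. -/
def preferredFrontier (conflicts : P → P → Prop) (R : Region) (K : Anchor) (V : Finset (Block n P)) :
    Finset (Block n P) :=
  (tips V).filter fun x =>
    ∀ y ∈ tips V, y ≠ x → ConflictingBlocks conflicts y x → ¬ Beats R K V y x

/-- The ledger of a view: the ancestor closure of the preferred frontier. -/
def ledger (conflicts : P → P → Prop) (R : Region) (K : Anchor) (V : Finset (Block n P)) :
    Finset (Block n P) :=
  V.filter fun b => ∃ x ∈ preferredFrontier conflicts R K V, AncEq b x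

/-- `B` is in the ledger, at distance at least `k` beneath the preferred frontier. -/
def IsDeep (conflicts : P → P → Prop) (R : Region) (K : Anchor) (k : ℕ)
    (V : Finset (Block n P)) (B : Block n P) : Prop :=
  B ∈ ledger conflicts R K V ∧
    ∀ x ∈ preferredFrontier conflicts R K V, ∀ m, RefPath m B x → k ≤ m

/-! ### Synchronous execution against an adversary -/

/-- `created`: all blocks created so far. `pub`: the view that all honest parties share. -/
structure State (n : ℕ) (P : Type u) where
  created : Finset (Block n P)
  pub : Finset (Block n P)

/-- One realization of the randomness: eligibility and label of each validator in each slot, and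
the payload that an honest validator samples in a given slot on a given view. -/
structure Coins (n : ℕ) (P : Type u) where
  eligible : ℕ → Fin n → Bool
  label : ℕ → Fin n → ℝ
  payload : ℕ → Fin n → Finset (Block n P) → P

/-- An adversarial strategy. In slot `t`, given the state at the end of the previous slot, the
honest blocks of slot `t` and the validators eligible in slot `t`, `forge` gives for each eligible
corrupt validator the references and the payload of at most one new block. Then `release` names,
given the updated state, the blocks to be shown to the honest parties; all others stay withheld. -/
structure Strategy (n : ℕ) (P : Type u) where
  forge : ℕ → State n P → Finset (Block n P) → Finset (Fin n) → Fin n →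
    Option (List (Block n P) × P)
  forge_valid : ∀ t σ fresh el v r a, forge t σ fresh el v = some (r, a) →
    r ≠ [] ∧ ∀ b ∈ r, b ∈ σ.created
  release : ℕ → State n P → Finset (Block n P)

def eligibleSet (c : Coins n P) (t : ℕ) : Finset (Fin n) :=
  Finset.univ.filter fun v => c.eligible t v = true

/-- Every eligible honest validator creates one block referencing all tips of the honest view. -/
def honestBlocks (honest : Finset (Fin n)) (c : Coins n P) (t : ℕ) (V : Finset (Block n P)) :
    Finset (Block n P) :=
  (eligibleSet c t ∩ honest).image fun v =>
    Block.mk t v (c.payload t v V) (c.label t v) (tips V).toList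

def forgedBlocks (honest : Finset (Fin n)) (A : Strategy n P) (c : Coins n P) (t : ℕ)
    (σ : State n P) (fresh : Finset (Block n P)) : Finset (Block n P) :=
  (eligibleSet c t \ honest).biUnion fun v =>
    match A.forge t σ fresh (eligibleSet c t) v with
    | none => ∅
    | some (r, a) => {Block.mk t v a (c.label t v) r}

/-- Reception: a released block is accepted if all its ancestors are known or released as well. -/
def accept (base released : Finset (Block n P)) : Finset (Block n P) :=
  base ∪ released.filter fun b => ∀ a, AncEq a b → a ∈ base ∪ released

/-- One slot. Honest blocks reach all honest parties by the end of the slot. -/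
def step (honest : Finset (Fin n)) (A : Strategy n P) (c : Coins n P) (t : ℕ) (σ : State n P) :
    State n P :=
  let fresh := honestBlocks honest c t σ.pub
  let σ' : State n P :=
    { created := σ.created ∪ fresh ∪ forgedBlocks honest A c t σ fresh
      pub := σ.pub ∪ fresh }
  { created := σ'.created
    pub := accept σ'.pub (A.release t σ' ∩ σ'.created) }

/-- The state at the end of slot `t`; slot `0` holds genesis only. -/
def exec (honest : Finset (Fin n)) (A : Strategy n P) (c : Coins n P) : ℕ → State n P
  | 0 => { created := {Block.genesis}, pub := {Block.genesis} }
  | t + 1 => step honest A c (t + 1) (exec honest A c t)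

/-- An honest block that is `k`-deep at the end of slot `t₁` is no longer in the honest ledger at
the end of slot `t₂`, and blocks that had been withheld for at least `k` slots at the end of `t₁`
have been revealed in between. -/
def WithholdingReversion (conflicts : P → P → Prop) (R : Region) (K : Anchor)
    (honest : Finset (Fin n)) (A : Strategy n P) (c : Coins n P) (k t₁ t₂ : ℕ) : Prop :=
  (∃ B : Block n P, (∃ v ∈ honest, B.validator = some v) ∧
      IsDeep conflicts R K k (exec honest A c t₁).pub B ∧
      B ∉ ledger conflicts R K (exec honest A c t₂).pub) ∧
    (preferredFrontier conflicts R K (exec honest A c t₂).pub).Nonempty ∧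
    ∃ b ∈ (exec honest A c t₁).created, b.slot + k ≤ t₁ ∧
      b ∉ (exec honest A c t₁).pub ∧ b ∈ (exec honest A c t₂).pub

end SubDAG

end

/-!
The adversary uses one corrupt validator, which secretly grows a branch whose blocks reference
genesis and all earlier blocks of the branch, with payloads in conflict with everything created so
far. A branch of `m` blocks holds about `m ^ 2 / 2` references. Honest blocks reference only the
tips of the public view, which during an epoch without releases are the honest blocks of the last
productive slot; so the public blocks have boundedly many references each and their total grows only
linearly. Once the epoch is long enough the branch therefore outweighs the public DAG: its top block
alone has more references than any public block, which decides the comparison by descendants, and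
the whole branch has more references than all public blocks together, which decides the comparison
by ancestors. Genesis is the only common ancestor of the branch and a public block, so both choices
of the anchor agree. Releasing the branch reverts every honest block of the epoch.

A deep reversion only takes sufficiently many slots in which the corrupt validator and a fixed
honest one are both eligible, and eligibility of the corrupt one in the release slot. The expected
number of such slots in an epoch of length `ℓ` is at least `p ^ 3 * ℓ`, so by the reverse Markov
inequality at least `p ^ 3 / 2 * ℓ` of them occur with probability at least `p ^ 3 / 2`, whatever
the depth.
-/

noncomputable section

namespace SubDAG

/-! ### The reference DAG -/

section ReferenceDAG

variable {n : ℕ} {P : Type*} {V N : Finset (Block n P)} {a b d x y : Block n P}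

theorem Edge.sizeOf_lt (h : Edge a b) : sizeOf a < sizeOf b := by
  cases b with
  | genesis => simp [Edge, Block.refs] at h
  | mk s v p l r =>
    have := List.sizeOf_lt_of_mem (List.mem_toFinset.1 h)
    simp only [Block.mk.sizeOf_spec]
    omega

theorem notMem_refs_self (b : Block n P) : b ∉ b.refs := fun h => lt_irrefl _ (Edge.sizeOf_lt h)

theorem Anc.sizeOf_lt (h : Anc a b) : sizeOf a < sizeOf b := by
  induction h with
  | single h => exact h.sizeOf_lt
  | tail _ h ih => exact ih.trans h.sizeOf_lt

theorem Anc.ne (h : Anc a b) : a ≠ b := by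
  rintro rfl
  exact lt_irrefl _ h.sizeOf_lt

theorem ancEq_iff_eq_or_anc : AncEq a b ↔ a = b ∨ Anc a b := by
  rw [AncEq, Relation.reflTransGen_iff_eq_or_transGen, eq_comm, Anc]

theorem anc_iff_exists_mem_refs : Anc a b ↔ ∃ d ∈ b.refs, AncEq a d := by
  simp only [Anc, Relation.TransGen.tail'_iff, AncEq, Edge, and_comm]

theorem anc_iff_of_refs_eq (h : x.refs = y.refs) : Anc a x ↔ Anc a y := by
  rw [anc_iff_exists_mem_refs, anc_iff_exists_mem_refs, h]

/-- A set of blocks that contains every reference of its members. -/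
def RefClosed (V : Finset (Block n P)) : Prop := ∀ b ∈ V, b.refs ⊆ V

theorem RefClosed.mem_of_ancEq (hV : RefClosed V) (h : AncEq a b) (hb : b ∈ V) : a ∈ V := by
  induction h using Relation.ReflTransGen.head_induction_on with
  | refl => exact hb
  | head h _ ih => exact hV _ ih h

theorem RefClosed.mem_of_anc (hV : RefClosed V) (hb : b.refs ⊆ V) (h : Anc a b) : a ∈ V := by
  obtain ⟨d, hd, had⟩ := anc_iff_exists_mem_refs.1 h
  exact hV.mem_of_ancEq had (hb hd)

/-- A set of blocks that can serve as a complete view: it contains genesis and all references of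
its members, and every member descends from genesis. -/
structure Rooted (V : Finset (Block n P)) : Prop where
  refClosed : RefClosed V
  genesis_mem : Block.genesis ∈ V
  genesis_ancEq : ∀ b ∈ V, AncEq Block.genesis b

theorem rooted_singleton_genesis : Rooted ({Block.genesis} : Finset (Block n P)) where
  refClosed := by simp [RefClosed, Block.refs]
  genesis_mem := Finset.mem_singleton_self _
  genesis_ancEq b hb := Finset.mem_singleton.1 hb ▸ Relation.ReflTransGen.refl

theorem Rooted.genesis_anc (hV : Rooted V) (hb : b ∈ V) (hne : b ≠ Block.genesis) :
    Anc Block.genesis b :=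
  (ancEq_iff_eq_or_anc.1 (hV.genesis_ancEq b hb)).resolve_left hne.symm

theorem Rooted.union (hV : Rooted V) (hne : ∀ b ∈ N, b.refs.Nonempty)
    (hsub : ∀ b ∈ N, b.refs ⊆ V) : Rooted (V ∪ N) where
  refClosed b hb := (Finset.mem_union.1 hb).elim
    (fun hb => (hV.refClosed b hb).trans Finset.subset_union_left)
    fun hb => (hsub b hb).trans Finset.subset_union_left
  genesis_mem := Finset.mem_union_left _ hV.genesis_mem
  genesis_ancEq b hb := (Finset.mem_union.1 hb).elim (hV.genesis_ancEq b) fun hb =>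
    have ⟨d, hd⟩ := hne b hb
    (hV.genesis_ancEq d (hsub b hb hd)).tail hd

theorem Rooted.of_subset (hV : Rooted V) (hN : RefClosed N) (hsub : N ⊆ V)
    (hg : Block.genesis ∈ N) : Rooted N :=
  ⟨hN, hg, fun b hb => hV.genesis_ancEq b (hsub hb)⟩

theorem mem_tips : b ∈ tips V ↔ b ∈ V ∧ ∀ d ∈ V, ¬ Edge b d := Finset.mem_filter

theorem tips_subset : tips V ⊆ V := Finset.filter_subset _ _

theorem tips_nonempty (hV : V.Nonempty) : (tips V).Nonempty := by
  obtain ⟨b, hb, hmax⟩ := V.exists_max_image sizeOf hV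
  exact ⟨b, mem_tips.2 ⟨hb, fun d hd h => (hmax d hd).not_gt h.sizeOf_lt⟩⟩

theorem RefClosed.eq_of_mem_tips (hV : RefClosed V) (hx : x ∈ tips V) (hd : d ∈ V)
    (h : AncEq x d) : d = x := by
  rcases Relation.ReflTransGen.cases_head h with h | ⟨e, he, hed⟩
  · exact h.symm
  · exact absurd he ((mem_tips.1 hx).2 e (hV.mem_of_ancEq hed hd))

/-- The blocks of `N` are new to `V`, and each references exactly the tips of `V`. This is the
shape of the set of honest blocks of one slot. -/
structure IsLayer (V N : Finset (Block n P)) : Prop where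
  disjoint : Disjoint V N
  refs_eq : ∀ b ∈ N, b.refs = tips V

theorem IsLayer.tips_union (h : IsLayer V N) (hV : RefClosed V) (hN : N.Nonempty) :
    tips (V ∪ N) = N := by
  have hnew : ∀ b ∈ N, b ∉ V := fun b hb hb' => Finset.disjoint_left.1 h.disjoint hb' hb
  ext b
  simp only [mem_tips, Finset.mem_union]
  refine ⟨?_, fun hb => ⟨.inr hb, ?_⟩⟩
  · rintro ⟨hb | hb, hedge⟩
    · obtain ⟨f, hf⟩ := hN
      have hbt : b ∈ f.refs := h.refs_eq f hf ▸ mem_tips.2 ⟨hb, fun d hd => hedge d (.inl hd)⟩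
      exact absurd hbt (hedge f (.inr hf))
    · exact hb
  · rintro d (hd | hd) he
    · exact hnew b hb (hV d hd he)
    · exact hnew b hb (tips_subset (h.refs_eq d hd ▸ he))

theorem IsLayer.rooted_union (h : IsLayer V N) (hV : Rooted V) : Rooted (V ∪ N) :=
  hV.union (fun b hb => h.refs_eq b hb ▸ tips_nonempty ⟨_, hV.genesis_mem⟩)
    fun b hb => h.refs_eq b hb ▸ tips_subset

/-- `C` bounds the number of references of every block of `V` and of every block that will
reference all tips of `V`. -/
structure RefsBounded (C : ℕ) (V : Finset (Block n P)) : Prop where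
  card_refs_le : ∀ b ∈ V, b.refs.card ≤ C
  card_tips_le : (tips V).card ≤ C

theorem RefClosed.refsBounded (hV : RefClosed V) {C : ℕ} (hC : V.card ≤ C) : RefsBounded C V where
  card_refs_le b hb := (Finset.card_le_card (hV b hb)).trans hC
  card_tips_le := (Finset.card_le_card tips_subset).trans hC

theorem RefsBounded.card_refs_union_le {C : ℕ} (h : RefsBounded C V) (hN : IsLayer V N) :
    ∀ b ∈ V ∪ N, b.refs.card ≤ C := fun b hb =>
  (Finset.mem_union.1 hb).elim (h.card_refs_le b) fun hb => hN.refs_eq b hb ▸ h.card_tips_le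

theorem RefsBounded.union {C : ℕ} (h : RefsBounded C V) (hV : RefClosed V) (hN : IsLayer V N)
    (hC : N.card ≤ C) : RefsBounded C (V ∪ N) where
  card_refs_le := h.card_refs_union_le hN
  card_tips_le := by
    rcases N.eq_empty_or_nonempty with rfl | hne
    · rw [Finset.union_empty]
      exact h.card_tips_le
    · rwa [hN.tips_union hV hne]

end ReferenceDAG

/-! ### The fork choice -/

section ForkChoice

variable {n : ℕ} {P : Type*} {conflicts : P → P → Prop} {R : Region} {K : Anchor}
  {V S : Finset (Block n P)} {b c x y : Block n P}

theorem ConflictingBlocks.ne_genesis (h : ConflictingBlocks conflicts x y) :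
    x ≠ Block.genesis ∧ y ≠ Block.genesis := by
  obtain ⟨a, b, hx, hy, -⟩ := h
  constructor <;> rintro rfl <;> contradiction

theorem Rooted.exists_isAnchor (hV : Rooted V) (hx : x ∈ V) (hy : y ∈ V)
    (hxg : x ≠ Block.genesis) (hyg : y ≠ Block.genesis) (K : Anchor) :
    ∃ c, IsAnchor K V x y c := by
  cases K with
  | genesis => exact ⟨_, rfl⟩
  | cca =>
    obtain ⟨c, hc, hmax⟩ := (V.filter fun c => Anc c x ∧ Anc c y).exists_max_image Block.slotKey
      ⟨_, Finset.mem_filter.2 ⟨hV.genesis_mem, hV.genesis_anc hx hxg, hV.genesis_anc hy hyg⟩⟩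
    exact ⟨c, Finset.mem_filter.1 hc,
      fun c' h h₁ h₂ => hmax c' (Finset.mem_filter.2 ⟨h, h₁, h₂⟩)⟩

theorem IsAnchor.anc_left (h : IsAnchor K V x y c) (hV : Rooted V) (hx : x ∈ V)
    (hxg : x ≠ Block.genesis) : Anc c x := by
  cases K with
  | cca => exact h.1.2.1
  | genesis => exact h ▸ hV.genesis_anc hx hxg

theorem IsAnchor.eq_genesis (h : IsAnchor K V x y c)
    (hxy : ∀ d, Anc d x → Anc d y → d = Block.genesis) : c = Block.genesis := by
  cases K with
  | cca => exact hxy c h.1.2.1 h.1.2.2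
  | genesis => exact h

theorem weight_descendants (hV : RefClosed V) (hx : x ∈ tips V) (hc : AncEq c x) :
    weight .descendants V x c = x.refs.card := by
  have hregion : V.filter (fun d => InRegion .descendants x d ∧ AncEq c d) = {x} := by
    ext d
    rw [Finset.mem_filter, Finset.mem_singleton]
    constructor
    · rintro ⟨hd, hxd, -⟩
      exact hV.eq_of_mem_tips hx hd hxd
    · rintro rfl
      exact ⟨tips_subset hx, .refl, hc⟩
  rw [weight, hregion, Finset.sum_singleton]

theorem weight_between (hx : x ∈ V) (hc : AncEq c x) :
    weight .between V x c =
      x.refs.card + ∑ d ∈ V.filter (fun d => Anc d x ∧ AncEq c d), d.refs.card := by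
  have hregion : V.filter (fun d => InRegion .between x d ∧ AncEq c d) =
      insert x (V.filter fun d => Anc d x ∧ AncEq c d) := by
    ext d
    rw [Finset.mem_filter, Finset.mem_insert, Finset.mem_filter, InRegion, ancEq_iff_eq_or_anc]
    constructor
    · rintro ⟨hd, rfl | hdx, hcd⟩
      exacts [.inl rfl, .inr ⟨hd, hdx, hcd⟩]
    · rintro (rfl | ⟨hd, hdx, hcd⟩)
      exacts [⟨hx, .inl rfl, hc⟩, ⟨hd, .inr hdx, hcd⟩]
  rw [weight, hregion, Finset.sum_insert fun h => (Finset.mem_filter.1 h).2.1.ne rfl]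

theorem weight_eq_of_refs_eq (hV : RefClosed V) (hx : x ∈ tips V) (hy : y ∈ tips V)
    (h : x.refs = y.refs) (hc : Anc c x) (R : Region) : weight R V x c = weight R V y c := by
  have hcy : Anc c y := (anc_iff_of_refs_eq h).1 hc
  cases R with
  | descendants =>
    rw [weight_descendants hV hx hc.to_reflTransGen, weight_descendants hV hy hcy.to_reflTransGen,
      h]
  | between =>
    rw [weight_between (tips_subset hx) hc.to_reflTransGen,
      weight_between (tips_subset hy) hcy.to_reflTransGen, h]
    simp only [anc_iff_of_refs_eq h]

theorem weight_between_le_sum (hS : RefClosed S) (hx : x ∈ S) :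
    weight .between V x c ≤ ∑ d ∈ S, d.refs.card :=
  Finset.sum_le_sum_of_subset fun _ hd => hS.mem_of_ancEq (Finset.mem_filter.1 hd).2.1 hx

theorem sum_le_weight_between (hS : S ⊆ V) (hx : ∀ d ∈ S, AncEq d x) (hc : ∀ d ∈ S, AncEq c d) :
    ∑ d ∈ S, d.refs.card ≤ weight .between V x c :=
  Finset.sum_le_sum_of_subset fun d hd => Finset.mem_filter.2 ⟨hS hd, hx d hd, hc d hd⟩

/-- All tips of `V` have the same references. -/
def UniformTips (V : Finset (Block n P)) : Prop :=
  ∀ x ∈ tips V, ∀ y ∈ tips V, x.refs = y.refs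

theorem IsLayer.uniformTips_union {N : Finset (Block n P)} (h : IsLayer V N) (hV : RefClosed V)
    (hN : N.Nonempty) : UniformTips (V ∪ N) := fun x hx y hy => by
  rw [h.tips_union hV hN] at hx hy
  rw [h.refs_eq x hx, h.refs_eq y hy]

/-- Uniform tips tie in weight, so the tip with the largest coin is undefeated. -/
theorem Rooted.preferredFrontier_nonempty (hV : Rooted V) (hunif : UniformTips V) :
    (preferredFrontier conflicts R K V).Nonempty := by
  obtain ⟨x, hx, hmax⟩ :=
    (tips V).exists_max_image Block.coinKey (tips_nonempty ⟨_, hV.genesis_mem⟩)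
  refine ⟨x, Finset.mem_filter.2 ⟨hx, ?_⟩⟩
  rintro y hy - hconf ⟨c, hc, hbeats⟩
  have hcy : Anc c y := hc.anc_left hV (tips_subset hy) hconf.ne_genesis.1
  rw [weight_eq_of_refs_eq hV.refClosed hy hx (hunif y hy x hx) hcy R] at hbeats
  rcases hbeats with hlt | ⟨-, hlt⟩
  exacts [lt_irrefl _ hlt, (hmax y hy).not_gt hlt]

theorem Rooted.preferredFrontier_eq_singleton (hV : Rooted V) (hx : x ∈ tips V)
    (hconf : ∀ y ∈ tips V, y ≠ x → ConflictingBlocks conflicts x y)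
    (hanc : ∀ y ∈ tips V, y ≠ x → ∀ d, Anc d x → Anc d y → d = Block.genesis)
    (hweight : ∀ y ∈ tips V, y ≠ x → weight R V y .genesis < weight R V x .genesis) :
    preferredFrontier conflicts R K V = {x} := by
  ext y
  rw [preferredFrontier, Finset.mem_filter, Finset.mem_singleton]
  constructor
  · rintro ⟨hy, hundefeated⟩
    by_contra hne
    obtain ⟨hxg, hyg⟩ := (hconf y hy hne).ne_genesis
    obtain ⟨c, hc⟩ := hV.exists_isAnchor (tips_subset hx) (tips_subset hy) hxg hyg K
    obtain rfl := hc.eq_genesis (hanc y hy hne)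
    exact hundefeated x hx (Ne.symm hne) (hconf y hy hne) ⟨_, hc, .inl (hweight y hy hne)⟩
  · rintro rfl
    refine ⟨hx, ?_⟩
    rintro z hz hne - ⟨c, hc, hbeats⟩
    obtain rfl := hc.eq_genesis fun d hdz hdy => hanc z hz hne d hdy hdz
    have := hweight z hz hne
    omega

/-- `B` belongs to the view `V`, every reference path from `B` to a tip of `V` has length at least
`m`, and either `B` is itself still a tip or all tips descend from it. The tips are uniform. -/
structure Buried (B : Block n P) (V : Finset (Block n P)) (m : ℕ) : Prop where
  mem : B ∈ V
  uniformTips : UniformTips V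
  le_length : ∀ x ∈ tips V, ∀ l, RefPath l B x → m ≤ l
  tip_or_ancEq : B ∈ tips V ∨ ∀ x ∈ tips V, AncEq B x

variable {B : Block n P} {N : Finset (Block n P)} {m : ℕ}

theorem IsLayer.buried (h : IsLayer V N) (hV : RefClosed V) (hB : B ∈ N) :
    Buried B (V ∪ N) 0 where
  mem := Finset.mem_union_right _ hB
  uniformTips := h.uniformTips_union hV ⟨B, hB⟩
  le_length _ _ _ _ := Nat.zero_le _
  tip_or_ancEq := .inl (by rwa [h.tips_union hV ⟨B, hB⟩])

theorem Buried.union (h : Buried B V m) (hV : RefClosed V) (hN : IsLayer V N)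
    (hne : N.Nonempty) : Buried B (V ∪ N) (m + 1) where
  mem := Finset.mem_union_left _ h.mem
  uniformTips := hN.uniformTips_union hV hne
  le_length x hx l hl := by
    rw [hN.tips_union hV hne] at hx
    cases l with
    | zero =>
      obtain rfl : B = x := hl
      exact absurd hx (Finset.disjoint_left.1 hN.disjoint h.mem)
    | succ l =>
      obtain ⟨d, hd, hdx⟩ := hl
      exact Nat.succ_le_succ (h.le_length d (hN.refs_eq x hx ▸ hdx) l hd)
  tip_or_ancEq := by
    refine .inr fun x hx => ?_
    rw [hN.tips_union hV hne] at hx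
    have hedge : ∀ d ∈ tips V, Edge d x := fun d hd => show d ∈ x.refs from hN.refs_eq x hx ▸ hd
    rcases h.tip_or_ancEq with hB | hall
    · exact Relation.ReflTransGen.single (hedge B hB)
    · obtain ⟨d, hd⟩ := tips_nonempty ⟨B, h.mem⟩
      exact (hall d hd).tail (hedge d hd)

theorem Buried.mono {k : ℕ} (h : Buried B V m) (hk : k ≤ m) : Buried B V k :=
  { h with le_length := fun x hx l hl => hk.trans (h.le_length x hx l hl) }

theorem Buried.isDeep {k : ℕ} (h : Buried B V m) (hV : Rooted V) (hm : 0 < m) (hk : k ≤ m) :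
    IsDeep conflicts R K k V B := by
  have htips : preferredFrontier conflicts R K V ⊆ tips V := Finset.filter_subset _ _
  refine ⟨Finset.mem_filter.2 ⟨h.mem, ?_⟩, fun x hx l hl =>
    hk.trans (h.le_length x (htips hx) l hl)⟩
  obtain ⟨x, hx⟩ := hV.preferredFrontier_nonempty (conflicts := conflicts) h.uniformTips
  have hB : B ∉ tips V := fun hB => hm.not_ge (h.le_length B hB 0 rfl)
  exact ⟨x, hx, h.tip_or_ancEq.resolve_left hB x (htips hx)⟩

end ForkChoice

/-! ### A withheld branch -/

section Branch

variable {n : ℕ} {P : Type*} {U Q : Finset (Block n P)} {x : Block n P}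

/-- A branch as withheld by the adversary: every block of it references genesis and all earlier
blocks of the branch. -/
inductive CompleteBranch : Finset (Block n P) → Prop
  | empty : CompleteBranch ∅
  | extend {Q : Finset (Block n P)} {x : Block n P} : CompleteBranch Q →
      x.refs = insert Block.genesis Q → CompleteBranch (insert x Q)

theorem notMem_of_refs_eq_insert (hx : x.refs = insert Block.genesis Q) : x ∉ Q := fun h =>
  notMem_refs_self x (hx ▸ Finset.mem_insert_of_mem h)

theorem CompleteBranch.genesis_notMem (hQ : CompleteBranch Q) : Block.genesis ∉ Q := by
  induction hQ with
  | empty => exact Finset.notMem_empty _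
  | extend _ hx ih =>
    rw [Finset.mem_insert, not_or]
    refine ⟨?_, ih⟩
    rintro rfl
    exact Finset.insert_ne_empty _ _ hx.symm

theorem CompleteBranch.refClosed_insert_genesis (hQ : CompleteBranch Q) :
    RefClosed (insert Block.genesis Q) := by
  induction hQ with
  | empty => simp [RefClosed, Block.refs]
  | @extend Q x _ hx ih =>
    have hsub : insert Block.genesis Q ⊆ insert Block.genesis (insert x Q) :=
      Finset.insert_subset_insert _ (Finset.subset_insert _ _)
    intro b hb
    rw [Finset.insert_comm, Finset.mem_insert] at hb
    rcases hb with rfl | hb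
    · exact hx.trans_subset hsub
    · exact (ih b hb).trans hsub

theorem CompleteBranch.two_mul_sum_card_refs (hQ : CompleteBranch Q) :
    2 * ∑ q ∈ Q, q.refs.card = Q.card * (Q.card + 1) := by
  induction hQ with
  | empty => simp
  | extend hQ hx ih =>
    have hxQ := notMem_of_refs_eq_insert hx
    rw [Finset.sum_insert hxQ, Finset.card_insert_of_notMem hxQ, hx,
      Finset.card_insert_of_notMem hQ.genesis_notMem, mul_add, ih]
    ring

theorem CompleteBranch.rooted_union (hQ : CompleteBranch Q) (hU : Rooted U) : Rooted (U ∪ Q) := by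
  induction hQ with
  | empty => rwa [Finset.union_empty]
  | @extend Q x _ hx ih =>
    have hsub : insert Block.genesis Q ⊆ U ∪ Q :=
      Finset.insert_subset ih.genesis_mem Finset.subset_union_right
    have hsplit : U ∪ insert x Q = U ∪ Q ∪ {x} := by
      rw [Finset.union_assoc, Finset.union_comm Q, Finset.insert_eq]
    rw [hsplit]
    exact ih.union (by simp [hx]) (by simpa [hx] using hsub)

theorem CompleteBranch.eq_genesis_of_anc {d : Block n P} (hQ : CompleteBranch Q)
    (hx : x.refs = insert Block.genesis Q) (hdisj : Disjoint U Q) (hd : d ∈ U) (h : Anc d x) :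
    d = Block.genesis :=
  (Finset.mem_insert.1 (hQ.refClosed_insert_genesis.mem_of_anc hx.subset h)).resolve_right
    (Finset.disjoint_left.1 hdisj hd)

theorem CompleteBranch.mem_tips_union (hQ : CompleteBranch Q) (hU : RefClosed U)
    (hx : x.refs = insert Block.genesis Q) (hxU : x ∉ U) : x ∈ tips (U ∪ insert x Q) := by
  refine mem_tips.2
    ⟨Finset.mem_union_right _ (Finset.mem_insert_self _ _), fun d hd (hxd : x ∈ d.refs) => ?_⟩
  rcases Finset.mem_union.1 hd with hd | hd
  · exact hxU (hU d hd hxd)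
  · have hrefs : d.refs ⊆ insert Block.genesis Q := by
      rcases Finset.mem_insert.1 hd with rfl | hd
      exacts [hx.subset, hQ.refClosed_insert_genesis d (Finset.mem_insert_of_mem hd)]
    exact notMem_refs_self x (hx ▸ hrefs hxd)

theorem mem_of_mem_tips_union {y : Block n P} (hx : x.refs = insert Block.genesis Q)
    (hy : y ∈ tips (U ∪ insert x Q)) (hyx : y ≠ x) : y ∈ U ∧ y ≠ Block.genesis := by
  obtain ⟨hyV, htip⟩ := mem_tips.1 hy
  have hyQ : y ∉ insert Block.genesis Q := fun h =>
    htip x (Finset.mem_union_right _ (Finset.mem_insert_self _ _))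
      (show y ∈ x.refs from hx ▸ h)
  simp only [Finset.mem_union, Finset.mem_insert, not_or] at hyV hyQ
  exact ⟨hyV.resolve_right (not_or.2 ⟨hyx, hyQ.2⟩), hyQ.1⟩

theorem CompleteBranch.weight_lt {y : Block n P} (hQ : CompleteBranch Q) (hU : Rooted U)
    (hx : x.refs = insert Block.genesis Q) (hxU : x ∉ U) (hy : y ∈ tips (U ∪ insert x Q))
    (hyU : y ∈ U) (hcard : y.refs.card < x.refs.card)
    (hsum : ∑ d ∈ U, d.refs.card < ∑ d ∈ insert x Q, d.refs.card) (R : Region) :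
    weight R (U ∪ insert x Q) y .genesis < weight R (U ∪ insert x Q) x .genesis := by
  have hV : Rooted (U ∪ insert x Q) := (hQ.extend hx).rooted_union hU
  have hxV : x ∈ tips (U ∪ insert x Q) := hQ.mem_tips_union hU.refClosed hx hxU
  cases R with
  | descendants =>
    rwa [weight_descendants hV.refClosed hy (hU.genesis_ancEq y hyU),
      weight_descendants hV.refClosed hxV (hV.genesis_ancEq x (tips_subset hxV))]
  | between =>
    have hbelow : ∀ d ∈ insert x Q, AncEq d x := by
      rintro d hd
      rcases Finset.mem_insert.1 hd with rfl | hd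
      · exact .refl
      · exact .single (show d ∈ x.refs from hx ▸ Finset.mem_insert_of_mem hd)
    calc weight .between (U ∪ insert x Q) y .genesis
        ≤ ∑ d ∈ U, d.refs.card := weight_between_le_sum hU.refClosed hyU
      _ < ∑ d ∈ insert x Q, d.refs.card := hsum
      _ ≤ weight .between (U ∪ insert x Q) x .genesis :=
          sum_le_weight_between Finset.subset_union_right hbelow
            fun d hd => hV.genesis_ancEq d (Finset.mem_union_right _ hd)

/-- Genesis is the only common ancestor of the top block of the branch and a block outside the
branch, so all four versions of the weight compare the whole branch with blocks of `U`. -/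
theorem CompleteBranch.preferredFrontier_union {conflicts : P → P → Prop}
    (hQ : CompleteBranch Q) (hU : Rooted U) (hx : x.refs = insert Block.genesis Q)
    (hdisj : Disjoint U (insert x Q))
    (hconf : ∀ y ∈ U, y ≠ Block.genesis → ConflictingBlocks conflicts x y)
    (hcard : ∀ y ∈ U, y.refs.card < x.refs.card)
    (hsum : ∑ d ∈ U, d.refs.card < ∑ d ∈ insert x Q, d.refs.card) (R : Region) (K : Anchor) :
    preferredFrontier conflicts R K (U ∪ insert x Q) = {x} := by
  obtain ⟨hxU, hdisjQ⟩ := Finset.disjoint_insert_right.1 hdisj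
  have hV : Rooted (U ∪ insert x Q) := (hQ.extend hx).rooted_union hU
  refine hV.preferredFrontier_eq_singleton (hQ.mem_tips_union hU.refClosed hx hxU)
    (fun y hy hyx => ?_) (fun y hy hyx d hdx hdy => ?_) fun y hy hyx => ?_ <;>
  obtain ⟨hyU, hyg⟩ := mem_of_mem_tips_union hx hy hyx
  · exact hconf y hyU hyg
  · exact hQ.eq_genesis_of_anc hx hdisjQ (hU.refClosed.mem_of_ancEq hdy.to_reflTransGen hyU) hdx
  · exact hQ.weight_lt hU hx hxU hy hyU (hcard y hyU) hsum R

theorem CompleteBranch.not_ancEq {B : Block n P} (hQ : CompleteBranch Q)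
    (hx : x.refs = insert Block.genesis Q) (hdisj : Disjoint U (insert x Q)) (hB : B ∈ U)
    (hne : B ≠ Block.genesis) : ¬ AncEq B x := by
  obtain ⟨hxU, hdisjQ⟩ := Finset.disjoint_insert_right.1 hdisj
  intro h
  rcases ancEq_iff_eq_or_anc.1 h with rfl | h
  exacts [hxU hB, hne (hQ.eq_genesis_of_anc hx hdisjQ hB h)]

end Branch

/-! ### Executions -/

section Execution

variable {n : ℕ} {P : Type*} {honest : Finset (Fin n)} {A : Strategy n P} {c : Coins n P} {t : ℕ}
  {σ : State n P} {b : Block n P} {V S base released fresh : Finset (Block n P)}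

theorem RefClosed.accept (h : RefClosed base) : RefClosed (accept base released) := by
  intro b hb a ha
  rcases Finset.mem_union.1 hb with hb | hb
  · exact Finset.mem_union_left _ (h b hb ha)
  · have hanc := (Finset.mem_filter.1 hb).2
    rcases Finset.mem_union.1 (hanc a (.single ha)) with ha' | ha'
    · exact Finset.mem_union_left _ ha'
    · exact Finset.mem_union_right _
        (Finset.mem_filter.2 ⟨ha', fun d hd => hanc d (hd.tail ha)⟩)

theorem accept_subset_union : accept base released ⊆ base ∪ released :=
  Finset.union_subset_union_right (Finset.filter_subset _ _)

theorem accept_empty : accept base ∅ = base := by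
  rw [accept, Finset.filter_empty, Finset.union_empty]

theorem accept_eq_released (hsub : base ⊆ released) (h : RefClosed released) :
    accept base released = released := by
  refine (accept_subset_union.trans_eq (Finset.union_eq_right.2 hsub)).antisymm fun b hb => ?_
  exact Finset.mem_union_right _
    (Finset.mem_filter.2 ⟨hb, fun a ha => Finset.mem_union_right _ (h.mem_of_ancEq ha hb)⟩)

theorem mem_honestBlocks : b ∈ honestBlocks honest c t V ↔ ∃ u ∈ honest, c.eligible t u = true ∧
    Block.mk t u (c.payload t u V) (c.label t u) (tips V).toList = b := by
  simp only [honestBlocks, eligibleSet, Finset.mem_image, Finset.mem_inter, Finset.mem_filter,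
    Finset.mem_univ, true_and, and_assoc, and_left_comm]

theorem slot_of_mem_honestBlocks (h : b ∈ honestBlocks honest c t V) : b.slot = t := by
  obtain ⟨u, -, -, rfl⟩ := mem_honestBlocks.1 h
  rfl

theorem refs_of_mem_honestBlocks (h : b ∈ honestBlocks honest c t V) : b.refs = tips V := by
  obtain ⟨u, -, -, rfl⟩ := mem_honestBlocks.1 h
  exact Finset.toList_toFinset _

theorem validator_of_mem_honestBlocks (h : b ∈ honestBlocks honest c t V) :
    ∃ u ∈ honest, b.validator = some u := by
  obtain ⟨u, hu, -, rfl⟩ := mem_honestBlocks.1 h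
  exact ⟨u, hu, rfl⟩

theorem card_honestBlocks_le : (honestBlocks honest c t V).card ≤ n :=
  Finset.card_image_le.trans (card_finset_fin_le _)

theorem mem_forgedBlocks : b ∈ forgedBlocks honest A c t σ fresh ↔
    ∃ u ∉ honest, c.eligible t u = true ∧ ∃ r a,
      A.forge t σ fresh (eligibleSet c t) u = some (r, a) ∧
        Block.mk t u a (c.label t u) r = b := by
  simp only [forgedBlocks, Finset.mem_biUnion, Finset.mem_sdiff]
  refine exists_congr fun u => ?_
  rcases A.forge t σ fresh (eligibleSet c t) u with _ | ⟨r, a⟩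
  · simp
  · simp [eligibleSet, and_assoc, and_left_comm, eq_comm (a := b)]

theorem slot_of_mem_forgedBlocks (h : b ∈ forgedBlocks honest A c t σ fresh) : b.slot = t := by
  obtain ⟨u, -, -, r, a, -, rfl⟩ := mem_forgedBlocks.1 h
  rfl

theorem refs_nonempty_of_mem_forgedBlocks (h : b ∈ forgedBlocks honest A c t σ fresh) :
    b.refs.Nonempty := by
  obtain ⟨u, -, -, r, a, hforge, rfl⟩ := mem_forgedBlocks.1 h
  exact (List.toFinset_nonempty_iff r).2 (A.forge_valid _ _ _ _ _ _ _ hforge).1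

theorem refs_subset_of_mem_forgedBlocks (h : b ∈ forgedBlocks honest A c t σ fresh) :
    b.refs ⊆ σ.created := by
  obtain ⟨u, -, -, r, a, hforge, rfl⟩ := mem_forgedBlocks.1 h
  exact fun d hd => (A.forge_valid _ _ _ _ _ _ _ hforge).2 d (List.mem_toFinset.1 hd)

theorem disjoint_honestBlocks_forgedBlocks :
    Disjoint (honestBlocks honest c t V) (forgedBlocks honest A c t σ fresh) := by
  refine Finset.disjoint_left.2 fun b hb hb' => ?_
  obtain ⟨u, hu, hbu⟩ := validator_of_mem_honestBlocks hb
  obtain ⟨u', hu', -, r, a, -, rfl⟩ := mem_forgedBlocks.1 hb'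
  obtain rfl : u' = u := Option.some.inj hbu
  exact hu' hu

theorem card_forgedBlocks_le :
    (forgedBlocks honest A c t σ fresh).card ≤ (eligibleSet c t \ honest).card := by
  refine (Finset.card_biUnion_le_card_mul _ _ 1 fun u _ => ?_).trans_eq (mul_one _)
  split <;> simp

theorem card_honestBlocks_add_card_forgedBlocks_le :
    (honestBlocks honest c t V).card + (forgedBlocks honest A c t σ fresh).card ≤ n :=
  calc (honestBlocks honest c t V).card + (forgedBlocks honest A c t σ fresh).card
      ≤ (eligibleSet c t ∩ honest).card + (eligibleSet c t \ honest).card :=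
        Nat.add_le_add Finset.card_image_le card_forgedBlocks_le
    _ = (eligibleSet c t).card := Finset.card_inter_add_card_sdiff _ _
    _ ≤ n := card_finset_fin_le _

/-- The blocks that are created but not public. -/
def State.withheld (σ : State n P) : Finset (Block n P) := σ.created \ σ.pub

/-- The largest number of blocks that can exist at the end of slot `t`, genesis included. -/
def maxBlocks (n t : ℕ) : ℕ := 1 + n * t

theorem maxBlocks_succ : maxBlocks n (t + 1) = maxBlocks n t + n := by
  simp only [maxBlocks]
  ring

/-- The invariants of every state reached at the end of slot `t`. -/
structure State.WellFormed (σ : State n P) (t : ℕ) : Prop where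
  created_rooted : Rooted σ.created
  pub_rooted : Rooted σ.pub
  pub_subset : σ.pub ⊆ σ.created
  slot_le : ∀ b ∈ σ.created, b.slot ≤ t
  card_le : σ.created.card ≤ maxBlocks n t

theorem created_step : (step honest A c t σ).created = σ.created ∪
    (honestBlocks honest c t σ.pub ∪
      forgedBlocks honest A c t σ (honestBlocks honest c t σ.pub)) :=
  Finset.union_assoc _ _ _

theorem pub_union_honestBlocks_subset (h : σ.pub ⊆ σ.created) :
    σ.pub ∪ honestBlocks honest c t σ.pub ⊆ (step honest A c t σ).created :=
  (Finset.union_subset_union_left h).trans Finset.subset_union_left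

theorem created_subset_created_step : σ.created ⊆ (step honest A c t σ).created :=
  created_step ▸ Finset.subset_union_left

theorem pub_step_of_release_eq_empty (hA : ∀ σ', A.release t σ' = ∅) :
    (step honest A c t σ).pub = σ.pub ∪ honestBlocks honest c t σ.pub := by
  simp only [step, hA, Finset.empty_inter, accept_empty]

namespace State.WellFormed

theorem notMem_created (h : σ.WellFormed t) (hb : b.slot = t + 1) : b ∉ σ.created := fun hb' =>
  (h.slot_le b hb').not_gt (by omega)

theorem isLayer_honestBlocks (h : σ.WellFormed t) :
    IsLayer σ.pub (honestBlocks honest c (t + 1) σ.pub) where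
  disjoint := Finset.disjoint_right.2 fun _ hb hb' =>
    h.notMem_created (slot_of_mem_honestBlocks hb) (h.pub_subset hb')
  refs_eq _ := refs_of_mem_honestBlocks

theorem created_step_rooted (h : σ.WellFormed t) : Rooted (step honest A c (t + 1) σ).created := by
  rw [created_step]
  refine h.created_rooted.union (fun b hb => ?_) fun b hb => ?_ <;>
    rcases Finset.mem_union.1 hb with hb | hb
  · exact refs_of_mem_honestBlocks hb ▸ tips_nonempty ⟨_, h.pub_rooted.genesis_mem⟩
  · exact refs_nonempty_of_mem_forgedBlocks hb
  · exact refs_of_mem_honestBlocks hb ▸ tips_subset.trans h.pub_subset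
  · exact refs_subset_of_mem_forgedBlocks hb

theorem card_pub_union_honestBlocks_le (h : σ.WellFormed t) :
    (σ.pub ∪ honestBlocks honest c (t + 1) σ.pub).card ≤ maxBlocks n (t + 1) :=
  calc (σ.pub ∪ honestBlocks honest c (t + 1) σ.pub).card
      ≤ maxBlocks n t + n := (Finset.card_union_le _ _).trans <| Nat.add_le_add
        ((Finset.card_le_card h.pub_subset).trans h.card_le) card_honestBlocks_le
    _ = maxBlocks n (t + 1) := maxBlocks_succ.symm

theorem card_created_step_le (h : σ.WellFormed t) :
    (step honest A c (t + 1) σ).created.card ≤ maxBlocks n (t + 1) :=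
  calc (step honest A c (t + 1) σ).created.card
      ≤ σ.created.card + n := by
        rw [created_step]
        exact (Finset.card_union_le _ _).trans (Nat.add_le_add_left
          ((Finset.card_union_le _ _).trans card_honestBlocks_add_card_forgedBlocks_le) _)
    _ ≤ maxBlocks n t + n := Nat.add_le_add_right h.card_le n
    _ = maxBlocks n (t + 1) := maxBlocks_succ.symm

theorem pub_step_subset (h : σ.WellFormed t) :
    (step honest A c (t + 1) σ).pub ⊆ (step honest A c (t + 1) σ).created :=
  accept_subset_union.trans <|
    Finset.union_subset (pub_union_honestBlocks_subset h.pub_subset) Finset.inter_subset_right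

theorem pub_step_rooted (h : σ.WellFormed t) : Rooted (step honest A c (t + 1) σ).pub :=
  have hbase : Rooted (σ.pub ∪ honestBlocks honest c (t + 1) σ.pub) :=
    h.isLayer_honestBlocks.rooted_union h.pub_rooted
  h.created_step_rooted.of_subset hbase.refClosed.accept h.pub_step_subset
    (Finset.mem_union_left _ hbase.genesis_mem)

theorem succ (h : σ.WellFormed t) : (step honest A c (t + 1) σ).WellFormed (t + 1) where
  created_rooted := h.created_step_rooted
  pub_rooted := h.pub_step_rooted
  pub_subset := h.pub_step_subset
  slot_le b hb := by
    rw [created_step, Finset.mem_union, Finset.mem_union] at hb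
    rcases hb with hb | hb | hb
    exacts [(h.slot_le b hb).trans (Nat.le_succ t), (slot_of_mem_honestBlocks hb).le,
      (slot_of_mem_forgedBlocks hb).le]
  card_le := h.card_created_step_le

theorem pub_step_of_release_eq_created (h : σ.WellFormed t)
    (hA : ∀ σ', A.release (t + 1) σ' = σ'.created) :
    (step honest A c (t + 1) σ).pub = (step honest A c (t + 1) σ).created := by
  have hbase := pub_union_honestBlocks_subset (honest := honest) (A := A) (c := c) (t := t + 1)
    h.pub_subset
  have hpub := accept_eq_released hbase h.created_step_rooted.refClosed
  rw [← hpub]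
  simp only [step, hA, Finset.inter_self]

theorem withheld_step_of_release_eq_empty (h : σ.WellFormed t)
    (hA : ∀ σ', A.release (t + 1) σ' = ∅) :
    (step honest A c (t + 1) σ).withheld = σ.withheld ∪
      forgedBlocks honest A c (t + 1) σ (honestBlocks honest c (t + 1) σ.pub) := by
  have hH : ∀ b ∈ honestBlocks honest c (t + 1) σ.pub, b ∉ σ.created := fun b hb =>
    h.notMem_created (slot_of_mem_honestBlocks hb)
  have hF : ∀ b ∈ forgedBlocks honest A c (t + 1) σ (honestBlocks honest c (t + 1) σ.pub),
      b ∉ σ.pub ∪ honestBlocks honest c (t + 1) σ.pub := fun b hb => by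
    rw [Finset.mem_union, not_or]
    exact ⟨fun hb' => h.notMem_created (slot_of_mem_forgedBlocks hb) (h.pub_subset hb'),
      Finset.disjoint_right.1 disjoint_honestBlocks_forgedBlocks hb⟩
  rw [State.withheld, created_step, pub_step_of_release_eq_empty hA, State.withheld]
  ext b
  have := hH b
  have := hF b
  simp only [Finset.mem_sdiff, Finset.mem_union] at *
  tauto

end State.WellFormed

theorem wellFormed_exec (honest : Finset (Fin n)) (A : Strategy n P) (c : Coins n P) (t : ℕ) :
    (exec honest A c t).WellFormed t := by
  induction t with
  | zero => exact ⟨rooted_singleton_genesis, rooted_singleton_genesis, subset_rfl,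
      fun b hb => (congrArg Block.slot (Finset.mem_singleton.1 hb)).le, le_rfl⟩
  | succ t ih => exact ih.succ

end Execution

/-! ### The withholding strategy -/

section Withholding

variable {n : ℕ} {P : Type*} {conflicts : P → P → Prop} {honest : Finset (Fin n)}
  {rival : Finset (Block n P) → P} {u v w : Fin n} {T : Set ℕ} {c : Coins n P} {a s t : ℕ}
  {σ : State n P} {B : Block n P}

/-- `rival` chooses, for every finite set of blocks, a payload in conflict with all payloads
carried by the set. -/
def IsRival (conflicts : P → P → Prop) (rival : Finset (Block n P) → P) : Prop :=
  ∀ S, ∀ b ∈ S, ∀ a, b.payload = some a → conflicts (rival S) a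

theorem exists_isRival (n : ℕ) (h : ∀ S : Finset P, ∃ a, ∀ x ∈ S, conflicts a x) :
    ∃ rival : Finset (Block n P) → P, IsRival conflicts rival := by
  choose rival hrival using fun S : Finset (Block n P) => h (S.biUnion fun b => b.payload.toFinset)
  exact ⟨rival, fun S b hb a ha =>
    hrival S a (Finset.mem_biUnion.2 ⟨b, hb, Option.mem_toFinset.2 ha⟩)⟩

theorem exists_payload_eq_some {b : Block n P} (h : b ≠ Block.genesis) :
    ∃ a, b.payload = some a := by
  cases b with
  | genesis => exact absurd rfl h
  | mk s u a y r => exact ⟨a, rfl⟩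

theorem insert_genesis_withheld_subset (hg : Block.genesis ∈ σ.created) :
    insert Block.genesis σ.withheld ⊆ σ.created :=
  Finset.insert_subset hg Finset.sdiff_subset

/-- In every slot in which the corrupt validator `v` is eligible it extends the withheld branch by
a block that references genesis and the whole branch. All other corrupt validators stay silent.
Everything is released in the slots of `T`, and nothing in any other slot. -/
def withholdingStrategy (rival : Finset (Block n P) → P) (v : Fin n) (T : Set ℕ) :
    Strategy n P where
  forge _ σ fresh _ u :=
    if u = v ∧ Block.genesis ∈ σ.created then
      some ((insert Block.genesis σ.withheld).toList, rival (σ.created ∪ fresh))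
    else none
  forge_valid _ σ fresh _ u r a h := by
    obtain ⟨⟨-, hg⟩, hra⟩ := (Option.ite_none_right_eq_some ..).1 h
    obtain ⟨rfl, -⟩ := Prod.mk.inj (Option.some.inj hra)
    exact ⟨by simp, fun b hb => insert_genesis_withheld_subset hg (Finset.mem_toList.1 hb)⟩
  release t σ := if t ∈ T then σ.created else ∅

/-- The block by which the corrupt validator `v` extends the withheld branch in slot `t`. -/
def rivalBlock (honest : Finset (Fin n)) (rival : Finset (Block n P) → P) (v : Fin n)
    (c : Coins n P) (t : ℕ) (σ : State n P) : Block n P :=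
  Block.mk t v (rival (σ.created ∪ honestBlocks honest c t σ.pub)) (c.label t v)
    (insert Block.genesis σ.withheld).toList

theorem refs_rivalBlock :
    (rivalBlock honest rival v c t σ).refs = insert Block.genesis σ.withheld :=
  Finset.toList_toFinset _

theorem mem_forgedBlocks_withholdingStrategy (hv : v ∉ honest) (hg : Block.genesis ∈ σ.created)
    {b : Block n P} :
    b ∈ forgedBlocks honest (withholdingStrategy rival v T) c t σ (honestBlocks honest c t σ.pub) ↔
      c.eligible t v = true ∧ b = rivalBlock honest rival v c t σ := by
  rw [mem_forgedBlocks]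
  constructor
  · rintro ⟨u, -, he, r, a, hforge, rfl⟩
    obtain ⟨⟨rfl, -⟩, hra⟩ := (Option.ite_none_right_eq_some ..).1 hforge
    obtain ⟨rfl, rfl⟩ := Prod.mk.inj (Option.some.inj hra)
    exact ⟨he, rfl⟩
  · rintro ⟨he, rfl⟩
    exact ⟨v, hv, he, _, _, if_pos ⟨rfl, hg⟩, rfl⟩

/-- The state at the end of slot `t` of an execution against the withholding strategy. -/
abbrev attackState (honest : Finset (Fin n)) (rival : Finset (Block n P) → P) (v : Fin n)
    (T : Set ℕ) (c : Coins n P) (t : ℕ) : State n P :=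
  exec honest (withholdingStrategy rival v T) c t

theorem pub_attackState_of_mem (ht : t ∈ T) :
    (attackState honest rival v T c t).pub = (attackState honest rival v T c t).created := by
  cases t with
  | zero => rfl
  | succ t => exact (wellFormed_exec _ _ _ t).pub_step_of_release_eq_created fun _ => if_pos ht

theorem pub_attackState_succ (ht : t + 1 ∉ T) :
    (attackState honest rival v T c (t + 1)).pub = (attackState honest rival v T c t).pub ∪
      honestBlocks honest c (t + 1) (attackState honest rival v T c t).pub :=
  pub_step_of_release_eq_empty fun _ => if_neg ht

theorem withheld_attackState_succ_of_eligible (hv : v ∉ honest) (ht : t + 1 ∉ T)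
    (he : c.eligible (t + 1) v = true) :
    (attackState honest rival v T c (t + 1)).withheld =
      insert (rivalBlock honest rival v c (t + 1) (attackState honest rival v T c t))
        (attackState honest rival v T c t).withheld := by
  have hσ := wellFormed_exec honest (withholdingStrategy rival v T) c t
  rw [attackState, exec, hσ.withheld_step_of_release_eq_empty fun _ => if_neg ht]
  ext b
  rw [Finset.mem_union, Finset.mem_insert, or_comm,
    mem_forgedBlocks_withholdingStrategy hv hσ.created_rooted.genesis_mem, and_iff_right he]

theorem withheld_attackState_succ_of_not_eligible (hv : v ∉ honest) (ht : t + 1 ∉ T)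
    (he : ¬ c.eligible (t + 1) v = true) :
    (attackState honest rival v T c (t + 1)).withheld =
      (attackState honest rival v T c t).withheld := by
  have hσ := wellFormed_exec honest (withholdingStrategy rival v T) c t
  rw [attackState, exec, hσ.withheld_step_of_release_eq_empty fun _ => if_neg ht,
    Finset.union_eq_left]
  intro b hb
  exact absurd ((mem_forgedBlocks_withholdingStrategy hv hσ.created_rooted.genesis_mem).1 hb).1 he

theorem pub_attackState_succ_of_mem (hv : v ∉ honest) (ht : t + 1 ∈ T)
    (he : c.eligible (t + 1) v = true) :
    (attackState honest rival v T c (t + 1)).pub =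
      (attackState honest rival v T c t).pub ∪
          honestBlocks honest c (t + 1) (attackState honest rival v T c t).pub ∪
        insert (rivalBlock honest rival v c (t + 1) (attackState honest rival v T c t))
          (attackState honest rival v T c t).withheld := by
  have hσ := wellFormed_exec honest (withholdingStrategy rival v T) c t
  rw [pub_attackState_of_mem ht, attackState, exec, created_step]
  ext b
  have hpub : b ∈ (attackState honest rival v T c t).pub →
    b ∈ (attackState honest rival v T c t).created := fun hb => hσ.pub_subset hb
  simp only [Finset.mem_union, Finset.mem_insert, State.withheld, Finset.mem_sdiff,
    mem_forgedBlocks_withholdingStrategy hv hσ.created_rooted.genesis_mem, he, true_and]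
  tauto

theorem State.WellFormed.disjoint_insert_rivalBlock (hσ : σ.WellFormed t) (hv : v ∉ honest) :
    Disjoint (σ.pub ∪ honestBlocks honest c (t + 1) σ.pub)
      (insert (rivalBlock honest rival v c (t + 1) σ) σ.withheld) := by
  have hx : rivalBlock honest rival v c (t + 1) σ ∉ honestBlocks honest c (t + 1) σ.pub := by
    intro hx
    obtain ⟨u, hu, huv⟩ := validator_of_mem_honestBlocks hx
    exact hv (Option.some.inj huv ▸ hu)
  rw [Finset.disjoint_insert_right, Finset.mem_union, not_or, Finset.disjoint_union_left]
  refine ⟨⟨fun h => hσ.notMem_created rfl (hσ.pub_subset h), hx⟩, Finset.disjoint_sdiff, ?_⟩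
  exact Finset.disjoint_left.2 fun b hb hb' =>
    hσ.notMem_created (slot_of_mem_honestBlocks hb) (Finset.mem_sdiff.1 hb').1

theorem State.WellFormed.conflictingBlocks_rivalBlock (hσ : σ.WellFormed t)
    (hrival : IsRival conflicts rival) {y : Block n P}
    (hy : y ∈ σ.pub ∪ honestBlocks honest c (t + 1) σ.pub) (hne : y ≠ Block.genesis) :
    ConflictingBlocks conflicts (rivalBlock honest rival v c (t + 1) σ) y := by
  obtain ⟨b, hb⟩ := exists_payload_eq_some hne
  exact ⟨_, b, rfl, hb,
    hrival _ y (Finset.union_subset_union_left hσ.pub_subset hy) b hb⟩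

theorem State.WellFormed.sum_card_refs_lt {C : ℕ} (hσ : σ.WellFormed t)
    (hbranch : CompleteBranch σ.withheld) (hrefs : RefsBounded C σ.pub)
    (hweight : 2 * (maxBlocks n (t + 1) * C) ≤ σ.withheld.card ^ 2) :
    ∑ d ∈ σ.pub ∪ honestBlocks honest c (t + 1) σ.pub, d.refs.card <
      ∑ d ∈ insert (rivalBlock honest rival v c (t + 1) σ) σ.withheld, d.refs.card := by
  have hbranch' := hbranch.extend (refs_rivalBlock (honest := honest) (rival := rival) (v := v)
    (c := c) (t := t + 1))
  have hcard : (insert (rivalBlock honest rival v c (t + 1) σ) σ.withheld).card =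
      σ.withheld.card + 1 :=
    Finset.card_insert_of_notMem (notMem_of_refs_eq_insert refs_rivalBlock)
  have hpub : ∑ d ∈ σ.pub ∪ honestBlocks honest c (t + 1) σ.pub, d.refs.card ≤
      maxBlocks n (t + 1) * C :=
    calc ∑ d ∈ σ.pub ∪ honestBlocks honest c (t + 1) σ.pub, d.refs.card
        ≤ (σ.pub ∪ honestBlocks honest c (t + 1) σ.pub).card * C :=
          Finset.sum_le_card_nsmul _ _ _ (hrefs.card_refs_union_le hσ.isLayer_honestBlocks)
      _ ≤ maxBlocks n (t + 1) * C := Nat.mul_le_mul_right C hσ.card_pub_union_honestBlocks_le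
  have hsum := hbranch'.two_mul_sum_card_refs
  rw [hcard] at hsum
  nlinarith

theorem preferredFrontier_release {C : ℕ} (hv : v ∉ honest) (hrival : IsRival conflicts rival)
    (ht : t + 1 ∈ T) (he : c.eligible (t + 1) v = true)
    (hbranch : CompleteBranch (attackState honest rival v T c t).withheld)
    (hrefs : RefsBounded C (attackState honest rival v T c t).pub)
    (hC : C ≤ (attackState honest rival v T c t).withheld.card)
    (hweight : 2 * (maxBlocks n (t + 1) * C) ≤
      (attackState honest rival v T c t).withheld.card ^ 2) (R : Region) (K : Anchor) :
    preferredFrontier conflicts R K (attackState honest rival v T c (t + 1)).pub =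
      {rivalBlock honest rival v c (t + 1) (attackState honest rival v T c t)} := by
  have hσ := wellFormed_exec honest (withholdingStrategy rival v T) c t
  rw [pub_attackState_succ_of_mem hv ht he]
  refine hbranch.preferredFrontier_union (hσ.isLayer_honestBlocks.rooted_union hσ.pub_rooted)
    refs_rivalBlock (hσ.disjoint_insert_rivalBlock hv)
    (fun y => hσ.conflictingBlocks_rivalBlock hrival) (fun y hy => ?_)
    (hσ.sum_card_refs_lt hbranch hrefs hweight) R K
  rw [refs_rivalBlock, Finset.card_insert_of_notMem hbranch.genesis_notMem, Nat.lt_succ_iff]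
  exact (hrefs.card_refs_union_le hσ.isLayer_honestBlocks y hy).trans hC

theorem notMem_ledger_of_preferredFrontier_eq {R : Region} {K : Anchor}
    {V : Finset (Block n P)} (hσ : σ.WellFormed t) (hv : v ∉ honest)
    (hbranch : CompleteBranch σ.withheld)
    (hF : preferredFrontier conflicts R K V = {rivalBlock honest rival v c (t + 1) σ})
    (hB : B ∈ σ.pub) (hne : B ≠ Block.genesis) : B ∉ ledger conflicts R K V := by
  intro hL
  obtain ⟨-, x, hx, hBx⟩ := Finset.mem_filter.1 hL
  rw [hF, Finset.mem_singleton] at hx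
  subst hx
  exact hbranch.not_ancEq refs_rivalBlock (hσ.disjoint_insert_rivalBlock hv)
    (Finset.mem_union_left _ hB) hne hBx

/-! ### One epoch -/

/-- The slots after `a` and up to `t` in which the validator `u` is eligible. -/
def eligibleSlots (c : Coins n P) (u : Fin n) (a t : ℕ) : Finset ℕ :=
  (Finset.Ioc a t).filter fun s => c.eligible s u = true

/-- The slots after `a` and up to `t` in which the validators `v` and `w` are both eligible. -/
def jointSlots (c : Coins n P) (v w : Fin n) (a t : ℕ) : Finset ℕ :=
  (Finset.Ioc a t).filter fun s => c.eligible s v = true ∧ c.eligible s w = true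

theorem eligibleSlots_self : eligibleSlots c u a a = ∅ := by
  rw [eligibleSlots, Finset.Ioc_self, Finset.filter_empty]

theorem card_eligibleSlots_le : (eligibleSlots c u a t).card ≤ t - a :=
  (Finset.card_filter_le _ _).trans_eq (Nat.card_Ioc a t)

theorem card_eligibleSlots_succ (hat : a ≤ t) : (eligibleSlots c u a (t + 1)).card =
    (eligibleSlots c u a t).card + if c.eligible (t + 1) u = true then 1 else 0 := by
  rw [eligibleSlots, ← Finset.insert_Ioc_right_eq_Ioc_add_one hat, Finset.filter_insert]
  split_ifs
  · rw [Finset.card_insert_of_notMem (by simp), eligibleSlots]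
  · rfl

theorem card_jointSlots_le : (jointSlots c v w a t).card ≤ (eligibleSlots c v a t).card :=
  Finset.card_le_card (Finset.monotone_filter_right _ fun _ _ => And.left)

theorem exists_first_jointSlot (h : (jointSlots c v w a t).Nonempty) :
    ∃ s, a ≤ s ∧ s + 1 ≤ t ∧ c.eligible (s + 1) v = true ∧ c.eligible (s + 1) w = true ∧
      (jointSlots c v w a t).card ≤ (eligibleSlots c w (s + 1) t).card + 1 := by
  obtain ⟨m, hm, hmin⟩ := (jointSlots c v w a t).exists_min_image id h
  obtain ⟨hIoc, hv, hw⟩ := Finset.mem_filter.1 hm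
  obtain ⟨ham, hmt⟩ := Finset.mem_Ioc.1 hIoc
  obtain ⟨s, rfl⟩ := Nat.exists_eq_succ_of_ne_zero (Nat.ne_zero_of_lt ham)
  refine ⟨s, Nat.le_of_lt_succ ham, hmt, hv, hw, ?_⟩
  rw [← Finset.card_erase_add_one hm]
  gcongr
  intro r hr
  obtain ⟨hne, hr⟩ := Finset.mem_erase.1 hr
  obtain ⟨hIoc, -, hrw⟩ := Finset.mem_filter.1 hr
  exact Finset.mem_filter.2 ⟨Finset.mem_Ioc.2
    ⟨lt_of_le_of_ne (hmin r hr) hne.symm, (Finset.mem_Ioc.1 hIoc).2⟩, hrw⟩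

theorem completeBranch_withheld (hv : v ∉ honest) (ha : a ∈ T) (hat : a ≤ t)
    (hT : ∀ s ∈ Finset.Ioc a t, s ∉ T) :
    CompleteBranch (attackState honest rival v T c t).withheld := by
  induction t, hat using Nat.le_induction with
  | base =>
    rw [State.withheld, pub_attackState_of_mem ha, Finset.sdiff_self]
    exact .empty
  | succ t hat ih =>
    have ht : t + 1 ∉ T := hT _ (Finset.right_mem_Ioc.2 (Nat.lt_succ_of_le hat))
    have hQ := ih fun s hs => hT s (Finset.Ioc_subset_Ioc_right t.le_succ hs)
    by_cases he : c.eligible (t + 1) v = true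
    · rw [withheld_attackState_succ_of_eligible hv ht he]
      exact hQ.extend refs_rivalBlock
    · rwa [withheld_attackState_succ_of_not_eligible hv ht he]

theorem card_withheld (hv : v ∉ honest) (ha : a ∈ T) (hat : a ≤ t)
    (hT : ∀ s ∈ Finset.Ioc a t, s ∉ T) :
    (attackState honest rival v T c t).withheld.card = (eligibleSlots c v a t).card := by
  induction t, hat using Nat.le_induction with
  | base =>
    rw [State.withheld, pub_attackState_of_mem ha, Finset.sdiff_self, eligibleSlots_self,
      Finset.card_empty, Finset.card_empty]
  | succ t hat ih =>
    have ht : t + 1 ∉ T := hT _ (Finset.right_mem_Ioc.2 (Nat.lt_succ_of_le hat))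
    have hcard := ih fun s hs => hT s (Finset.Ioc_subset_Ioc_right t.le_succ hs)
    rw [card_eligibleSlots_succ hat]
    split_ifs with he
    · rw [withheld_attackState_succ_of_eligible hv ht he,
        Finset.card_insert_of_notMem (notMem_of_refs_eq_insert refs_rivalBlock), hcard]
    · rw [withheld_attackState_succ_of_not_eligible hv ht he, hcard, add_zero]

theorem withheld_subset_withheld (hv : v ∉ honest) (hst : s ≤ t)
    (hT : ∀ r ∈ Finset.Ioc s t, r ∉ T) :
    (attackState honest rival v T c s).withheld ⊆ (attackState honest rival v T c t).withheld := by
  induction t, hst using Nat.le_induction with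
  | base => exact subset_rfl
  | succ t hst ih =>
    have ht : t + 1 ∉ T := hT _ (Finset.right_mem_Ioc.2 (Nat.lt_succ_of_le hst))
    refine (ih fun r hr => hT r (Finset.Ioc_subset_Ioc_right t.le_succ hr)).trans ?_
    by_cases he : c.eligible (t + 1) v = true
    · rw [withheld_attackState_succ_of_eligible hv ht he]
      exact Finset.subset_insert _ _
    · rw [withheld_attackState_succ_of_not_eligible hv ht he]

theorem refsBounded_pub (hat : a ≤ t) (hT : ∀ s ∈ Finset.Ioc a t, s ∉ T) :
    RefsBounded (maxBlocks n (a + 1)) (attackState honest rival v T c t).pub := by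
  induction t, hat using Nat.le_induction with
  | base =>
    have hσ := wellFormed_exec honest (withholdingStrategy rival v T) c a
    refine hσ.pub_rooted.refClosed.refsBounded ?_
    calc (attackState honest rival v T c a).pub.card
        ≤ maxBlocks n a := (Finset.card_le_card hσ.pub_subset).trans hσ.card_le
      _ ≤ maxBlocks n (a + 1) := maxBlocks_succ ▸ Nat.le_add_right _ _
  | succ t hat ih =>
    have ht : t + 1 ∉ T := hT _ (Finset.right_mem_Ioc.2 (Nat.lt_succ_of_le hat))
    have hσ := wellFormed_exec honest (withholdingStrategy rival v T) c t
    rw [pub_attackState_succ ht]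
    exact (ih fun s hs => hT s (Finset.Ioc_subset_Ioc_right t.le_succ hs)).union
      hσ.pub_rooted.refClosed hσ.isLayer_honestBlocks
      (card_honestBlocks_le.trans (maxBlocks_succ ▸ Nat.le_add_left _ _))

theorem buried_pub (hw : w ∈ honest) (hst : s + 1 ≤ t) (hT : ∀ r ∈ Finset.Ioc s t, r ∉ T)
    (hB : B ∈ honestBlocks honest c (s + 1) (attackState honest rival v T c s).pub) :
    Buried B (attackState honest rival v T c t).pub (eligibleSlots c w (s + 1) t).card := by
  induction t, hst using Nat.le_induction with
  | base =>
    have hσ := wellFormed_exec honest (withholdingStrategy rival v T) c s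
    rw [pub_attackState_succ (hT _ (Finset.right_mem_Ioc.2 s.lt_succ_self)), eligibleSlots_self]
    exact hσ.isLayer_honestBlocks.buried hσ.pub_rooted.refClosed hB
  | succ t hst ih =>
    have hσ := wellFormed_exec honest (withholdingStrategy rival v T) c t
    have hburied := ih fun r hr => hT r (Finset.Ioc_subset_Ioc_right t.le_succ hr)
    rw [pub_attackState_succ (hT _ (Finset.right_mem_Ioc.2 (by omega))),
      card_eligibleSlots_succ hst]
    rcases (honestBlocks honest c (t + 1)
      (attackState honest rival v T c t).pub).eq_empty_or_nonempty with hempty | hne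
    · have he : ¬ c.eligible (t + 1) w = true := fun he =>
        Finset.notMem_empty _ (hempty ▸ mem_honestBlocks.2 ⟨w, hw, he, rfl⟩)
      rwa [hempty, Finset.union_empty, if_neg he]
    · refine (hburied.union hσ.pub_rooted.refClosed hσ.isLayer_honestBlocks hne).mono ?_
      split_ifs <;> omega

theorem exists_honest_isDeep_notMem_ledger {k : ℕ} {R : Region} {K : Anchor}
    {V : Finset (Block n P)} (hv : v ∉ honest) (hw : w ∈ honest)
    (hst : s + 1 ≤ t) (hT : ∀ r ∈ Finset.Ioc s t, r ∉ T) (hew : c.eligible (s + 1) w = true)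
    (hbranch : CompleteBranch (attackState honest rival v T c t).withheld)
    (hF : preferredFrontier conflicts R K V =
      {rivalBlock honest rival v c (t + 1) (attackState honest rival v T c t)})
    (hk : k + 1 ≤ (eligibleSlots c w (s + 1) t).card) :
    ∃ B : Block n P, (∃ u ∈ honest, B.validator = some u) ∧
      IsDeep conflicts R K k (attackState honest rival v T c t).pub B ∧
        B ∉ ledger conflicts R K V := by
  have hσ := wellFormed_exec honest (withholdingStrategy rival v T) c t
  obtain ⟨B, hB⟩ : (honestBlocks honest c (s + 1)
    (attackState honest rival v T c s).pub).Nonempty := ⟨_, mem_honestBlocks.2 ⟨w, hw, hew, rfl⟩⟩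
  have hburied := buried_pub hw hst hT hB
  obtain ⟨u, hu, hBu⟩ := validator_of_mem_honestBlocks hB
  have hne : B ≠ Block.genesis := by
    rintro rfl
    cases hBu
  exact ⟨B, ⟨u, hu, hBu⟩, hburied.isDeep hσ.pub_rooted (by omega) (by omega),
    notMem_ledger_of_preferredFrontier_eq hσ hv hbranch hF hburied.mem hne⟩

theorem exists_old_withheld_released {k : ℕ} (hv : v ∉ honest) (ht : t + 1 ∈ T)
    (hst : s + 1 ≤ t) (hT : ∀ r ∈ Finset.Ioc s t, r ∉ T) (hev : c.eligible (s + 1) v = true)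
    (hk : s + 1 + k ≤ t) :
    ∃ b ∈ (attackState honest rival v T c t).created, b.slot + k ≤ t ∧
      b ∉ (attackState honest rival v T c t).pub ∧
        b ∈ (attackState honest rival v T c (t + 1)).pub := by
  have hs : s + 1 ∉ T := hT _ (Finset.mem_Ioc.2 ⟨s.lt_succ_self, hst⟩)
  have hx : rivalBlock honest rival v c (s + 1) (attackState honest rival v T c s) ∈
      (attackState honest rival v T c t).withheld :=
    withheld_subset_withheld hv hst (fun r hr => hT r (Finset.Ioc_subset_Ioc_left s.le_succ hr))
      (withheld_attackState_succ_of_eligible hv hs hev ▸ Finset.mem_insert_self _ _)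
  obtain ⟨hcreated, hpub⟩ := Finset.mem_sdiff.1 hx
  refine ⟨_, hcreated, hk, hpub, ?_⟩
  rw [pub_attackState_of_mem ht]
  exact created_subset_created_step hcreated

theorem withholdingReversion_of_epoch {k : ℕ} (hv : v ∉ honest) (hw : w ∈ honest)
    (hrival : IsRival conflicts rival) (ha : a ∈ T) (ht : t + 1 ∈ T)
    (hT : ∀ s ∈ Finset.Ioc a t, s ∉ T) (he : c.eligible (t + 1) v = true)
    (hk : k + 2 ≤ (jointSlots c v w a t).card)
    (hcard : maxBlocks n (a + 1) ≤ (jointSlots c v w a t).card)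
    (hweight : 2 * (maxBlocks n (t + 1) * maxBlocks n (a + 1)) ≤ (jointSlots c v w a t).card ^ 2)
    (R : Region) (K : Anchor) :
    WithholdingReversion conflicts R K honest (withholdingStrategy rival v T) c k t (t + 1) := by
  obtain ⟨s, has, hst, hev, hew, hsw⟩ :=
    exists_first_jointSlot (Finset.card_pos.1 (by omega : 0 < (jointSlots c v w a t).card))
  have hat : a ≤ t := by omega
  have hTs : ∀ r ∈ Finset.Ioc s t, r ∉ T := fun r hr => hT r (Finset.Ioc_subset_Ioc_left has hr)
  have hbranch := completeBranch_withheld (rival := rival) (c := c) hv ha hat hT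
  have hjoint : (jointSlots c v w a t).card ≤ (attackState honest rival v T c t).withheld.card :=
    card_jointSlots_le.trans_eq (card_withheld hv ha hat hT).symm
  have hF := preferredFrontier_release hv hrival ht he hbranch (refsBounded_pub hat hT)
    (hcard.trans hjoint) (hweight.trans (Nat.pow_le_pow_left hjoint 2)) R K
  have hlen : (eligibleSlots c w (s + 1) t).card ≤ t - (s + 1) := card_eligibleSlots_le
  exact ⟨exists_honest_isDeep_notMem_ledger hv hw hst hTs hew hbranch hF (by omega),
    hF ▸ Finset.singleton_nonempty _,
    exists_old_withheld_released hv ht hst hTs hev (by omega)⟩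

end Withholding

/-! ### Probability -/

theorem card_filter_mem_eq_sum_indicator {Ω ι : Type*} (S : Finset ι) (A : ι → Set Ω) (ω : Ω) :
    ((S.filter fun i => ω ∈ A i).card : ℝ) = ∑ i ∈ S, (A i).indicator 1 ω := by
  simp [Set.indicator_apply]

section Probability

variable {Ω ι : Type*} [MeasurableSpace Ω] {μ : Measure Ω}

theorem measurableSet_forall_mem_eq_true {f : ι → Ω → Bool} (hf : ∀ i, Measurable (f i))
    (s : Finset ι) : MeasurableSet {ω | ∀ i ∈ s, f i ω = true} := by
  simp only [Set.ofPred_forall]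
  exact s.measurableSet_biInter fun i _ => hf i (measurableSet_singleton true)

theorem pow_card_le_measure_forall_mem_eq_true {f : ι → Ω → Bool} (hf : iIndepFun f μ)
    {q : ENNReal} (hq : ∀ i, q ≤ μ {ω | f i ω = true}) (s : Finset ι) :
    q ^ s.card ≤ μ {ω | ∀ i ∈ s, f i ω = true} := by
  have hInter : {ω | ∀ i ∈ s, f i ω = true} = ⋂ i ∈ s, f i ⁻¹' {true} := by
    ext ω
    simp
  rw [hInter, hf.measure_inter_preimage_eq_mul s fun i _ => measurableSet_singleton true]
  exact Finset.pow_card_le_prod _ _ _ fun i _ => hq i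

theorem integral_le_add_mul_measureReal [IsProbabilityMeasure μ] {X : Ω → ℝ}
    (hX : Measurable X) (hint : Integrable X μ) {a b : ℝ} (ha : 0 ≤ a) (hb : ∀ ω, X ω ≤ b) :
    ∫ ω, X ω ∂μ ≤ a + b * μ.real {ω | a ≤ X ω} := by
  have hE : MeasurableSet {ω | a ≤ X ω} := measurableSet_le measurable_const hX
  have hintE : Integrable ({ω | a ≤ X ω}.indicator fun _ => b) μ :=
    (integrable_const b).indicator hE
  have hle : ∀ ω, X ω ≤ a + {ω | a ≤ X ω}.indicator (fun _ => b) ω := fun ω => by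
    by_cases hω : a ≤ X ω
    · rw [Set.indicator_of_mem (show ω ∈ {ω | a ≤ X ω} from hω)]
      linarith [hb ω]
    · rw [Set.indicator_of_notMem (show ω ∉ {ω | a ≤ X ω} from hω)]
      linarith
  calc ∫ ω, X ω ∂μ ≤ ∫ ω, (a + {ω | a ≤ X ω}.indicator (fun _ => b) ω) ∂μ :=
        integral_mono hint ((integrable_const a).add hintE) hle
    _ = a + b * μ.real {ω | a ≤ X ω} := by
        rw [integral_add (integrable_const a) hintE, integral_indicator_const b hE, integral_const,
          probReal_univ, one_smul, smul_eq_mul, mul_comm]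

theorem measurable_card_filter_mem {S : Finset ι} {A : ι → Set Ω}
    (hA : ∀ i ∈ S, MeasurableSet (A i)) :
    Measurable fun ω => ((S.filter fun i => ω ∈ A i).card : ℝ) := by
  simp only [card_filter_mem_eq_sum_indicator]
  exact Finset.measurable_sum _ fun i hi => measurable_one.indicator (hA i hi)

theorem half_le_measureReal_card_filter_mem [IsProbabilityMeasure μ] {S : Finset ι}
    {A : ι → Set Ω} (hA : ∀ i ∈ S, MeasurableSet (A i)) {q : ℝ}
    (hq : ∀ i ∈ S, q ≤ μ.real (A i)) (hS : S.Nonempty) {m : ℝ} (hm₀ : 0 ≤ m)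
    (hm : m ≤ q / 2 * S.card) :
    q / 2 ≤ μ.real {ω | m ≤ (S.filter fun i => ω ∈ A i).card} := by
  have hind : ∀ i ∈ S, Integrable ((A i).indicator (1 : Ω → ℝ)) μ := fun i hi =>
    (integrable_const (1 : ℝ)).indicator (hA i hi)
  have hint : Integrable (fun ω => ((S.filter fun i => ω ∈ A i).card : ℝ)) μ := by
    simp only [card_filter_mem_eq_sum_indicator]
    exact integrable_finsetSum _ hind
  have hlower : S.card * q ≤ ∫ ω, ((S.filter fun i => ω ∈ A i).card : ℝ) ∂μ := by
    simp only [card_filter_mem_eq_sum_indicator]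
    rw [integral_finsetSum _ hind, ← nsmul_eq_mul]
    refine Finset.card_nsmul_le_sum _ _ _ fun i hi => ?_
    rw [integral_indicator_one (hA i hi)]
    exact hq i hi
  have hupper := integral_le_add_mul_measureReal (measurable_card_filter_mem hA) hint hm₀
    fun ω => Nat.cast_le.2 (Finset.card_filter_le S _)
  have hcard : (0 : ℝ) < S.card := Nat.cast_pos.2 hS.card_pos
  exact le_of_mul_le_mul_left (by linarith) hcard

end Probability

/-! ### Release slots -/

/-- How often the two validators have to be jointly eligible in the epoch after slot `a`, whose
length is `r` times this number. The bound on the number of blocks in slot `a + r + 1` makes up for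
the epoch length depending on the required number itself. -/
def requiredCount (n r a k : ℕ) : ℕ :=
  2 * (maxBlocks n (a + r + 1) * maxBlocks n (a + 1)) + k

/-- The slots in which the withheld branch is released; the epoch that precedes
`releaseSlot n r (k + 1)` is meant to produce a reversion of depth `k`. -/
def releaseSlot (n r : ℕ) : ℕ → ℕ
  | 0 => 0
  | k + 1 => releaseSlot n r k + r * requiredCount n r (releaseSlot n r k) k + 1

theorem releaseSlot_strictMono (n r : ℕ) : StrictMono (releaseSlot n r) :=
  strictMono_nat_of_lt_succ fun k => by
    rw [releaseSlot]
    omega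

theorem notMem_range_releaseSlot {n r k s : ℕ}
    (hs : s ∈ Finset.Ioo (releaseSlot n r k) (releaseSlot n r (k + 1))) :
    s ∉ Set.range (releaseSlot n r) := by
  rintro ⟨j, rfl⟩
  rw [Finset.mem_Ioo, (releaseSlot_strictMono n r).lt_iff_lt,
    (releaseSlot_strictMono n r).lt_iff_lt] at hs
  omega

theorem maxBlocks_pos (n t : ℕ) : 0 < maxBlocks n t := by
  rw [maxBlocks]
  omega

theorem add_two_le_requiredCount (n r a k : ℕ) : k + 2 ≤ requiredCount n r a k := by
  have := Nat.mul_pos (maxBlocks_pos n (a + r + 1)) (maxBlocks_pos n (a + 1))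
  rw [requiredCount]
  omega

theorem requiredCount_pos (n r a k : ℕ) : 0 < requiredCount n r a k :=
  (Nat.succ_pos _).trans_le (add_two_le_requiredCount n r a k)

theorem maxBlocks_le_requiredCount (n r a k : ℕ) :
    maxBlocks n (a + 1) ≤ requiredCount n r a k := by
  have := Nat.le_mul_of_pos_left (maxBlocks n (a + 1)) (maxBlocks_pos n (a + r + 1))
  rw [requiredCount]
  omega

theorem maxBlocks_add_mul_le (n a r : ℕ) {m : ℕ} (hm : 0 < m) :
    maxBlocks n (a + r * m + 1) ≤ maxBlocks n (a + r + 1) * m := by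
  have h : 1 + n * (a + 1) ≤ (1 + n * (a + 1)) * m := Nat.le_mul_of_pos_right _ hm
  calc maxBlocks n (a + r * m + 1) = 1 + n * (a + 1) + n * r * m := by rw [maxBlocks]; ring
    _ ≤ (1 + n * (a + 1)) * m + n * r * m := by gcongr
    _ = maxBlocks n (a + r + 1) * m := by rw [maxBlocks]; ring

theorem weight_le_requiredCount_sq (n r a k : ℕ) :
    2 * (maxBlocks n (a + r * requiredCount n r a k + 1) * maxBlocks n (a + 1)) ≤
      requiredCount n r a k ^ 2 := by
  have hle : 2 * (maxBlocks n (a + r + 1) * maxBlocks n (a + 1)) ≤ requiredCount n r a k :=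
    Nat.le_add_right _ _
  calc 2 * (maxBlocks n (a + r * requiredCount n r a k + 1) * maxBlocks n (a + 1))
      ≤ 2 * (maxBlocks n (a + r + 1) * requiredCount n r a k * maxBlocks n (a + 1)) := by
        gcongr
        exact maxBlocks_add_mul_le n a r (requiredCount_pos n r a k)
    _ = 2 * (maxBlocks n (a + r + 1) * maxBlocks n (a + 1)) * requiredCount n r a k := by ring
    _ ≤ requiredCount n r a k ^ 2 := by
        rw [sq]
        gcongr

/-- The last slot of the epoch between `releaseSlot n r k` and `releaseSlot n r (k + 1)`. -/
def lastEpochSlot (n r k : ℕ) : ℕ :=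
  releaseSlot n r k + r * requiredCount n r (releaseSlot n r k) k

theorem releaseSlot_succ (n r k : ℕ) : releaseSlot n r (k + 1) = lastEpochSlot n r k + 1 :=
  rfl

theorem requiredCount_le_mul_sub_releaseSlot {n r k : ℕ} {q : ℝ} (hr : 1 ≤ q * r) :
    requiredCount n r (releaseSlot n r k) k ≤
      q * (lastEpochSlot n r k - releaseSlot n r k : ℕ) := by
  rw [lastEpochSlot, Nat.add_sub_cancel_left, Nat.cast_mul, ← mul_assoc]
  exact le_mul_of_one_le_left (Nat.cast_nonneg _) hr

section GoodEpoch

variable {n : ℕ} {P Ω : Type*} {coins : Ω → Coins n P} {v w : Fin n} {a t m : ℕ}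

/-- The event that, in the epoch `(a, t]`, the validators `v` and `w` are jointly eligible at least
`m` times and `v` can then create the releasing block in slot `t + 1`. -/
def goodEpoch (coins : Ω → Coins n P) (v w : Fin n) (a t m : ℕ) : Set Ω :=
  {ω | (coins ω).eligible (t + 1) v = true ∧ m ≤ (jointSlots (coins ω) v w a t).card}

theorem goodEpoch_eq_setOf_card_filter (hm : 0 < m) :
    goodEpoch coins v w a t m = {ω | (m : ℝ) ≤ ((Finset.Ioc a t).filter fun s =>
      ω ∈ {ω | ∀ i ∈ ({(t + 1, v), (s, v), (s, w)} : Finset (ℕ × Fin n)),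
        (coins ω).eligible i.1 i.2 = true}).card} := by
  ext ω
  simp only [goodEpoch, jointSlots, Set.mem_ofPred_eq, Nat.cast_le, Finset.mem_insert,
    Finset.mem_singleton, forall_eq_or_imp, forall_eq]
  by_cases he : (coins ω).eligible (t + 1) v = true
  · simp only [he, true_and]
  · simpa [he] using hm.ne'

variable [MeasurableSpace Ω] {μ : Measure Ω}

theorem measurableSet_goodEpoch
    (hmeas : ∀ t v, Measurable fun ω => (coins ω).eligible t v) (hm : 0 < m) :
    MeasurableSet (goodEpoch coins v w a t m) := by
  rw [goodEpoch_eq_setOf_card_filter hm]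
  exact measurableSet_le measurable_const <| measurable_card_filter_mem fun s _ =>
    measurableSet_forall_mem_eq_true (f := fun (i : ℕ × Fin n) ω => (coins ω).eligible i.1 i.2)
      (fun i => hmeas i.1 i.2) _

theorem pow_three_half_le_measureReal_goodEpoch [IsProbabilityMeasure μ] {p : ℝ} (hp : 0 ≤ p)
    (hmeas : ∀ t v, Measurable fun ω => (coins ω).eligible t v)
    (hindep : iIndepFun (fun (i : ℕ × Fin n) ω => (coins ω).eligible i.1 i.2) μ)
    (hprob : ∀ t v, ENNReal.ofReal p ≤ μ {ω | (coins ω).eligible t v = true})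
    (hvw : v ≠ w) (hm : 0 < m) (hle : m ≤ p ^ 3 / 2 * (t - a : ℕ)) :
    p ^ 3 / 2 ≤ μ.real (goodEpoch coins v w a t m) := by
  have hat : a < t := by
    by_contra! hta
    rw [Nat.sub_eq_zero_of_le hta, Nat.cast_zero, mul_zero] at hle
    exact hle.not_gt (Nat.cast_pos.2 hm)
  rw [goodEpoch_eq_setOf_card_filter hm]
  refine half_le_measureReal_card_filter_mem (fun s _ => measurableSet_forall_mem_eq_true
    (f := fun (i : ℕ × Fin n) ω => (coins ω).eligible i.1 i.2) (fun i => hmeas i.1 i.2) _)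
    (fun s hs => ?_) (Finset.nonempty_Ioc.2 hat) m.cast_nonneg (by rwa [Nat.card_Ioc])
  have hst : t + 1 ≠ s := by
    have := (Finset.mem_Ioc.1 hs).2
    omega
  have hcard : ({(t + 1, v), (s, v), (s, w)} : Finset (ℕ × Fin n)).card = 3 :=
    Finset.card_eq_three.2 ⟨_, _, _, by simp [hst], by simp [hst], by simp [hvw], rfl⟩
  have hpow := pow_card_le_measure_forall_mem_eq_true hindep (fun i => hprob i.1 i.2)
    {(t + 1, v), (s, v), (s, w)}
  rw [hcard, ← ENNReal.ofReal_pow hp] at hpow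
  exact (ENNReal.ofReal_le_iff_le_toReal (measure_ne_top μ _)).1 hpow

end GoodEpoch

theorem withholdingReversion_of_mem_goodEpoch {n : ℕ} {P Ω : Type*} {coins : Ω → Coins n P}
    {honest : Finset (Fin n)} {conflicts : P → P → Prop} {rival : Finset (Block n P) → P}
    {v w : Fin n} {r k : ℕ} {ω : Ω} (hv : v ∉ honest) (hw : w ∈ honest)
    (hrival : IsRival conflicts rival)
    (hω : ω ∈ goodEpoch coins v w (releaseSlot n r k) (lastEpochSlot n r k)
      (requiredCount n r (releaseSlot n r k) k)) (R : Region) (K : Anchor) :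
    WithholdingReversion conflicts R K honest
      (withholdingStrategy rival v (Set.range (releaseSlot n r))) (coins ω) k
      (lastEpochSlot n r k) (lastEpochSlot n r k + 1) := by
  obtain ⟨he, hcount⟩ := hω
  refine withholdingReversion_of_epoch hv hw hrival (Set.mem_range_self k)
    (releaseSlot_succ n r k ▸ Set.mem_range_self (k + 1))
    (fun s hs => notMem_range_releaseSlot (k := k) ?_) he
    ((add_two_le_requiredCount n r _ k).trans hcount)
    ((maxBlocks_le_requiredCount n r _ k).trans hcount)
    ((weight_le_requiredCount_sq n r _ k).trans (Nat.pow_le_pow_left hcount 2)) R K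
  rw [Finset.mem_Ioc] at hs
  rw [Finset.mem_Ioo, releaseSlot_succ]
  omega

end SubDAG

end

open SubDAG in
theorem mainTheorem11_general {n : ℕ} {P : Type*} (honest : Finset (Fin n))
    (some_honest : honest.Nonempty) (some_corrupt : honest ≠ Finset.univ)
    (conflicts : P → P → Prop) (conflicts_exist : ∀ S : Finset P, ∃ a, ∀ x ∈ S, conflicts a x)
    {Ω : Type*} [MeasurableSpace Ω] (μ : Measure Ω) [IsProbabilityMeasure μ]
    (coins : Ω → Coins n P) (p : ℝ) (p_pos : 0 < p)
    (eligible_meas : ∀ t v, Measurable fun ω => (coins ω).eligible t v)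
    (eligible_indep : iIndepFun (fun (i : ℕ × Fin n) ω => (coins ω).eligible i.1 i.2) μ)
    (eligible_prob : ∀ t v, ENNReal.ofReal p ≤ μ {ω | (coins ω).eligible t v = true}) :
    ∃ A : Strategy n P, ∃ ε : ℝ, 0 < ε ∧ ∀ k : ℕ, ∃ t : ℕ,
      ∃ E : Set Ω, MeasurableSet E ∧ ENNReal.ofReal ε ≤ μ E ∧
        ∀ ω ∈ E, ∀ R K, WithholdingReversion conflicts R K honest A (coins ω) k t (t + 1) := by
  obtain ⟨w, hw⟩ := some_honest
  obtain ⟨v, hv⟩ : ∃ v, v ∉ honest := by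
    simpa [Finset.eq_univ_iff_forall] using some_corrupt
  obtain ⟨rival, hrival⟩ := exists_isRival n conflicts_exist
  obtain ⟨r, hr⟩ : ∃ r : ℕ, 1 ≤ p ^ 3 / 2 * r :=
    (exists_nat_ge (1 / (p ^ 3 / 2))).imp fun r hr => (div_le_iff₀' (by positivity)).1 hr
  refine ⟨withholdingStrategy rival v (Set.range (releaseSlot n r)), p ^ 3 / 2, by positivity,
    fun k => ⟨lastEpochSlot n r k, goodEpoch coins v w (releaseSlot n r k) (lastEpochSlot n r k)
      (requiredCount n r (releaseSlot n r k) k), ?_, ?_,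
      fun ω hω => withholdingReversion_of_mem_goodEpoch hv hw hrival hω⟩⟩
  · exact measurableSet_goodEpoch eligible_meas (requiredCount_pos _ _ _ _)
  · refine ENNReal.ofReal_le_of_le_toReal <| pow_three_half_le_measureReal_goodEpoch p_pos.le
      eligible_meas eligible_indep eligible_prob (ne_of_mem_of_not_mem hw hv).symm
      (requiredCount_pos _ _ _ _) (requiredCount_le_mul_sub_releaseSlot hr)

theorem mainTheorem11 {n : ℕ} {P : Type*}
    (honest : Finset (Fin n)) (honest_majority : n < 2 * honest.card)
    (some_corrupt : honest ≠ Finset.univ)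
    (conflicts : P → P → Prop) (conflicts_symm : ∀ a b, conflicts a b → conflicts b a)
    (conflicts_exist : ∀ S : Finset P, ∃ a, ∀ x ∈ S, conflicts a x)
    (R : SubDAG.Region) (K : SubDAG.Anchor)
    {Ω : Type*} [MeasurableSpace Ω] (μ : Measure Ω) [IsProbabilityMeasure μ]
    (coins : Ω → SubDAG.Coins n P) (p : ℝ) (p_pos : 0 < p) (p_le_one : p ≤ 1)
    (eligible_meas : ∀ t v, Measurable fun ω => (coins ω).eligible t v)
    (eligible_indep : iIndepFun (fun (i : ℕ × Fin n) ω => (coins ω).eligible i.1 i.2) μ)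
    (eligible_prob : ∀ t v, μ {ω | (coins ω).eligible t v = true} = ENNReal.ofReal p) :
    ∃ A : SubDAG.Strategy n P, ∃ ε : ℝ, 0 < ε ∧
      ∀ k : ℕ, ∃ t₁ t₂ : ℕ, t₁ < t₂ ∧
        ∃ E : Set Ω, MeasurableSet E ∧ ENNReal.ofReal ε ≤ μ E ∧
          ∀ ω ∈ E, SubDAG.WithholdingReversion conflicts R K honest A (coins ω) k t₁ t₂ := by
  have ⟨A, ε, hε, h⟩ := mainTheorem11_general honest (Finset.card_pos.1 (by omega)) some_corrupt
    conflicts conflicts_exist μ coins p p_pos eligible_meas eligible_indep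
    fun t v => (eligible_prob t v).ge
  exact ⟨A, ε, hε, fun k => have ⟨t, E, hE, hμE, hrev⟩ := h k
    ⟨t, t + 1, t.lt_succ_self, E, hE, hμE, fun ω hω => hrev ω hω R K⟩⟩
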